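/- Let $s>\frac32$, let $H^s=H^s(\mathbb{R})$ be the Sobolev space of real-valued functions with norm $\|u\|_s=\|(1-\partial_x^2)^{s/2}u\|_{L^2(\mathbb{R})}$, and consider the Cauchy problem $$u_t-u_{txx}=u_xu_{xx}-uu_x,\qquad u(0,\cdot)=u_0, \tag{1}$$ where the equation is understood, for each $t$, in the sense of distributions in $x$, with right-hand side $\partial_x\left(\tfrac12u_x^2-\tfrac12u^2\right)$. A solution of (1) on $[0,T)$, $0<T\le\infty$, is a function $u\in C([0,T);H^s)\cap C^1([0,T);H^s)$ satisfying (1) for all $t\in[0,T)$. For every $u_0\in H^s$ there is a maximal existence time $T=T(u_0)\in(0,\infty]$ such that the following hold. 1. (Existence) Problem (1) has a solution $u=u(\cdot,u_0)$ on $[0,T(u_0))$. The existence time is bounded below in terms of $\|u_0\|_s$: there is a function $\delta:\mathbb{R}\to(0,\infty)$, depending only on $s$, such that $T(u_0)\ge\delta(R)$ whenever $\|u_0\|_s\le R$. 2. (Uniqueness) If $v$ is a solution of (1) on $[0,S)$ with the same initial value $u_0$, then $S\le T(u_0)$ and $v=u(\cdot,u_0)$ on $[0,S)$. 3. (Continuous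 dependence) The map $u_0\mapsto u(\cdot,u_0)$ is continuous from $H^s$ into $C([0,T);H^s)\cap C^1([0,T);H^s)$ in the following sense: for $u_0\in H^s$ and $0\le\tau<T(u_0)$, one has $T(v_0)>\tau$ for all $v_0$ in a neighbourhood of $u_0$ in $H^s$, and as $v_0\to u_0$ in $H^s$, $u(t,v_0)\to u(t,u_0)$ and $u_t(t,v_0)\to u_t(t,u_0)$ in $H^s$, uniformly for $t\in[0,\tau]$. 4. (Blow-up) If $T=T(u_0)<\infty$, then $\lim_{t\uparrow T}\|u(t,\cdot)\|_s=\infty$. -/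

import Mathlib

open MeasureTheory Filter Set
open scoped FourierTransform Topology SchwartzMap ENNReal

/-! ### The real Sobolev spaces `H^s(ℝ)`, `s ≥ 0` -/

/-- The inclusion of real-valued into complex-valued `L²` functions on the line. -/
noncomputable def complexify : Lp ℝ 2 (volume : Measure ℝ) →L[ℝ] Lp ℂ 2 (volume : Measure ℝ) :=
  Complex.ofRealCLM.compLpL 2 volume

/-- The symbol of `(1 - ∂ₓ²)^{s/2}`. With the convention `𝓕 u ξ = ∫ exp (-2πi x ξ) u x dx`
the operator `∂ₓ` has symbol `2πiξ`. -/
noncomputable def besselWeight (s ξ : ℝ) : ℝ := (1 + (2 * Real.pi * ξ) ^ 2) ^ (s / 2)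

/-- The function `ξ ↦ (1 + (2πξ)²)^{s/2} û(ξ)`. -/
noncomputable def weightedFourier (s : ℝ) (u : Lp ℝ 2 (volume : Measure ℝ)) (ξ : ℝ) : ℂ :=
  (besselWeight s ξ : ℂ) * (𝓕 (complexify u) : Lp ℂ 2 (volume : Measure ℝ)) ξ

lemma weightedFourier_add (s : ℝ) (u v : Lp ℝ 2 (volume : Measure ℝ)) :
    weightedFourier s (u + v) =ᵐ[volume] weightedFourier s u + weightedFourier s v := by
  have h : 𝓕 (complexify (u + v)) = 𝓕 (complexify u) + 𝓕 (complexify v) := by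
    rw [map_add, FourierTransform.fourier_add]
  filter_upwards [Lp.coeFn_add (𝓕 (complexify u)) (𝓕 (complexify v))] with ξ hξ
  simp only [weightedFourier, h, hξ, Pi.add_apply, mul_add]

lemma weightedFourier_smul (s c : ℝ) (u : Lp ℝ 2 (volume : Measure ℝ)) :
    weightedFourier s (c • u) =ᵐ[volume] c • weightedFourier s u := by
  have h : 𝓕 (complexify (c • u)) = (c : ℂ) • 𝓕 (complexify u) := by
    rw [map_smul, ← FourierTransform.fourier_smul]
    rfl
  filter_upwards [Lp.coeFn_smul (c : ℂ) (𝓕 (complexify u))] with ξ hξ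
  simp only [weightedFourier, h, hξ, Pi.smul_apply, smul_eq_mul, Complex.real_smul]
  ring

/-- For `s ≥ 0`: the real-valued `u ∈ L²(ℝ)` with `(1 + (2πξ)²)^{s/2} û ∈ L²(ℝ)`. -/
noncomputable def sobolevSubmodule (s : ℝ) : Submodule ℝ (Lp ℝ 2 (volume : Measure ℝ)) where
  carrier := {u | MemLp (weightedFourier s u) 2 volume}
  add_mem' {u v} hu hv := (memLp_congr_ae (weightedFourier_add s u v)).2 (hu.add hv)
  zero_mem' := by
    have h := weightedFourier_smul s 0 0
    rw [zero_smul, zero_smul] at h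
    exact (memLp_congr_ae h).2 MemLp.zero
  smul_mem' c u hu := (memLp_congr_ae (weightedFourier_smul s c u)).2 (hu.const_smul c)

lemma memLp_weightedFourier_iff {s : ℝ} (hs : 0 ≤ s) (u : Lp ℝ 2 (volume : Measure ℝ)) :
    MemLp (weightedFourier s u) 2 volume ↔
      MemLp (fun ξ : ℝ => (((1 + ‖ξ‖ ^ 2) ^ (s / 2) : ℝ) : ℂ) *
        (𝓕 (complexify u) : Lp ℂ 2 (volume : Measure ℝ)) ξ) 2 volume := by
  have hm := Lp.aestronglyMeasurable (𝓕 (complexify u) : Lp ℂ 2 (volume : Measure ℝ))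
  have hπ := Real.pi_gt_three
  have c1 : Continuous fun ξ : ℝ => (((1 + ‖ξ‖ ^ 2) ^ (s / 2) : ℝ) : ℂ) :=
    Complex.continuous_ofReal.comp
      (Continuous.rpow_const (by fun_prop) fun ξ => Or.inl (by positivity))
  have c2 : Continuous fun ξ : ℝ => (besselWeight s ξ : ℂ) :=
    Complex.continuous_ofReal.comp
      (Continuous.rpow_const (by fun_prop) fun ξ => Or.inl (by positivity))
  have h1 (ξ : ℝ) : 0 ≤ (1 + ‖ξ‖ ^ 2) ^ (s / 2) := by positivity
  have h2 (ξ : ℝ) : 0 ≤ besselWeight s ξ := by unfold besselWeight; positivity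
  constructor <;> intro h
  · refine h.mono (c1.aestronglyMeasurable.mul hm) (ae_of_all _ fun ξ => ?_)
    rw [weightedFourier, norm_mul, norm_mul, Complex.norm_real, Complex.norm_real]
    refine mul_le_mul_of_nonneg_right ?_ (norm_nonneg _)
    rw [Real.norm_of_nonneg (h1 ξ), Real.norm_of_nonneg (h2 ξ), besselWeight]
    refine Real.rpow_le_rpow (by positivity) ?_ (by positivity)
    rw [Real.norm_eq_abs, sq_abs]
    nlinarith [mul_nonneg (sq_nonneg ξ) (show (0 : ℝ) ≤ (2 * Real.pi) ^ 2 - 1 by nlinarith)]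
  · refine h.of_le_mul (c := ((2 * Real.pi) ^ 2) ^ (s / 2)) (c2.aestronglyMeasurable.mul hm)
      (ae_of_all _ fun ξ => ?_)
    rw [weightedFourier, norm_mul, norm_mul, Complex.norm_real, Complex.norm_real, ← mul_assoc]
    refine mul_le_mul_of_nonneg_right ?_ (norm_nonneg _)
    rw [Real.norm_of_nonneg (h1 ξ), Real.norm_of_nonneg (h2 ξ), besselWeight,
      ← Real.mul_rpow (by positivity) (by positivity)]
    refine Real.rpow_le_rpow (by positivity) ?_ (by positivity)
    rw [Real.norm_eq_abs, sq_abs]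
    nlinarith

/-- For `s ≥ 0` the space is that of the real-valued `L²` functions which lie in Mathlib's Sobolev
space of order `s`. -/
theorem mem_sobolevSubmodule_iff {s : ℝ} (hs : 0 ≤ s) (u : Lp ℝ 2 (volume : Measure ℝ)) :
    u ∈ sobolevSubmodule s ↔
      TemperedDistribution.MemSobolev s 2 (complexify u : 𝓢'(ℝ, ℂ)) := by
  change MemLp (weightedFourier s u) 2 volume ↔ _
  rw [memLp_weightedFourier_iff hs, TemperedDistribution.memSobolev_iff_exists_smulLeftCLM_fourier,
    Lp.fourier_toTemperedDistribution_eq]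
  have hw : Function.HasTemperateGrowth
      (fun ξ : ℝ => (((1 + ‖ξ‖ ^ 2) ^ (s / 2) : ℝ) : ℂ)) := by fun_prop
  set F : Lp ℂ 2 (volume : Measure ℝ) := 𝓕 (complexify u)
  constructor
  · intro h
    refine ⟨h.toLp _, ?_⟩
    ext φ
    rw [TemperedDistribution.smulLeftCLM_apply_apply, Lp.toTemperedDistribution_apply,
      Lp.toTemperedDistribution_apply]
    refine integral_congr_ae ?_
    filter_upwards [h.coeFn_toLp] with ξ hξ
    rw [hξ, SchwartzMap.smulLeftCLM_apply_apply hw]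
    simp only [smul_eq_mul]
    ring
  · rintro ⟨f', hf'⟩
    refine (memLp_congr_ae (?_ : _ =ᵐ[volume] f')).2 (Lp.memLp f')
    refine ae_eq_of_integral_contDiff_smul_eq ?_ ((Lp.memLp f').locallyIntegrable (by norm_num)) ?_
    · rw [← locallyIntegrableOn_univ]
      refine LocallyIntegrableOn.continuousOn_mul
        (((Lp.memLp F).locallyIntegrable (by norm_num)).locallyIntegrableOn _)
        hw.1.continuous.continuousOn isOpen_univ.isLocallyClosed
    · intro g hg hc
      have hg₁ : HasCompactSupport (Complex.ofRealCLM ∘ g) := hc.comp_left rfl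
      have hg₂ : ContDiff ℝ (⊤ : ℕ∞) (Complex.ofRealCLM ∘ g) := by fun_prop
      have h := congrArg (fun T : 𝓢'(ℝ, ℂ) => T (hg₁.toSchwartzMap hg₂)) hf'
      simp only [TemperedDistribution.smulLeftCLM_apply_apply, Lp.toTemperedDistribution_apply,
        SchwartzMap.smulLeftCLM_apply_apply hw] at h
      have e (ξ : ℝ) : (hg₁.toSchwartzMap hg₂) ξ = (g ξ : ℂ) := rfl
      simp only [e, smul_eq_mul] at h
      simp only [Complex.real_smul]
      rw [← h]
      refine integral_congr_ae (ae_of_all _ fun ξ => ?_)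
      ring

/-- The space `H^s(ℝ)` (`s ≥ 0`) of real-valued functions; its norm, given below, is
`‖u‖_s = ‖(1 + (2πξ)²)^{s/2} û‖_{L²} = ‖(1 - ∂ₓ²)^{s/2} u‖_{L²}`. -/
def SobolevH (s : ℝ) : Type := sobolevSubmodule s

namespace SobolevH

noncomputable instance (s : ℝ) : AddCommGroup (SobolevH s) :=
  inferInstanceAs (AddCommGroup (sobolevSubmodule s))

noncomputable instance (s : ℝ) : Module ℝ (SobolevH s) :=
  inferInstanceAs (Module ℝ (sobolevSubmodule s))

/-- The `L²` function underlying an element of `H^s(ℝ)`. -/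
noncomputable def toL2 {s : ℝ} : SobolevH s →ₗ[ℝ] Lp ℝ 2 (volume : Measure ℝ) :=
  (sobolevSubmodule s).subtype

lemma memLp_weightedFourier {s : ℝ} (u : SobolevH s) :
    MemLp (weightedFourier s (toL2 u)) 2 volume := u.2

/-- The map `u ↦ (1 + (2πξ)²)^{s/2} û` from `H^s(ℝ)` to `L²(ℝ; ℂ)`. -/
noncomputable def bessel (s : ℝ) : SobolevH s →ₗ[ℝ] Lp ℂ 2 (volume : Measure ℝ) where
  toFun u := (memLp_weightedFourier u).toLp _
  map_add' u v := by
    rw [← MemLp.toLp_add, MemLp.toLp_eq_toLp_iff, map_add]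
    exact weightedFourier_add s _ _
  map_smul' c u := by
    rw [RingHom.id_apply, ← MemLp.toLp_const_smul, MemLp.toLp_eq_toLp_iff, map_smul]
    exact weightedFourier_smul s c _

lemma bessel_injective (s : ℝ) : Function.Injective (bessel s) := by
  rw [injective_iff_map_eq_zero]
  intro u hu
  have h1 : weightedFourier s (toL2 u) =ᵐ[volume] 0 := by
    have h := (memLp_weightedFourier u).coeFn_toLp
    rw [show (memLp_weightedFourier u).toLp _ = 0 from hu] at h
    exact h.symm.trans (Lp.coeFn_zero _ _ _)
  have h2 : 𝓕 (complexify (toL2 u)) = 0 := by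
    rw [Lp.eq_zero_iff_ae_eq_zero]
    filter_upwards [h1] with ξ hξ
    have hw : besselWeight s ξ ≠ 0 := by unfold besselWeight; positivity
    simpa [weightedFourier, hw] using hξ
  have h3 : complexify (toL2 u) = 0 := by
    rw [← norm_eq_zero, ← Lp.norm_fourier_eq, h2, norm_zero]
  have h4 : toL2 u = 0 := by
    rw [Lp.eq_zero_iff_ae_eq_zero] at h3 ⊢
    filter_upwards [h3, Complex.ofRealCLM.coeFn_compLpL (p := 2) (μ := volume) (toL2 u)]
      with x hx hx'
    rw [complexify, hx'] at hx
    simpa using hx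
  exact Subtype.ext h4

noncomputable instance (s : ℝ) : NormedAddCommGroup (SobolevH s) :=
  NormedAddCommGroup.induced (SobolevH s) (Lp ℂ 2 (volume : Measure ℝ)) (bessel s)
    (bessel_injective s)

noncomputable instance (s : ℝ) : NormedSpace ℝ (SobolevH s) :=
  NormedSpace.induced ℝ (SobolevH s) (Lp ℂ 2 (volume : Measure ℝ)) (bessel s)

end SobolevH

/-! ### The equation `u_t - u_txx = u_x u_xx - u u_x` -/

/-- `g ∈ L²(ℝ)` is the distributional derivative of `f ∈ L²(ℝ)`. -/
def IsWeakDeriv (f g : Lp ℝ 2 (volume : Measure ℝ)) : Prop :=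
  ∀ φ : 𝓢(ℝ, ℝ), ∫ x, f x * deriv φ x = -∫ x, g x * φ x

/-- The equation `w - w_xx = u_x u_xx - u u_x` between functions `u, w` of the space variable, in
the sense of (tempered) distributions; the right-hand side is `(u_x²/2 - u²/2)_x`, where `u_x` is
an `L²` function. -/
def ThetaZeroEq (u w : Lp ℝ 2 (volume : Measure ℝ)) : Prop :=
  ∃ v : Lp ℝ 2 (volume : Measure ℝ), IsWeakDeriv u v ∧
    ∀ φ : 𝓢(ℝ, ℝ), ∫ x, w x * (φ x - deriv (deriv φ) x) =
      -∫ x, (v x ^ 2 / 2 - u x ^ 2 / 2) * deriv φ x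

/-- The interval `[0, T)`, where `T` may be `∞`. -/
def timeInterval (T : EReal) : Set ℝ := {t : ℝ | 0 ≤ t ∧ (t : EReal) < T}

/-- `u ∈ C([0,T); H^s) ∩ C¹([0,T); H^s)` solves `u_t - u_txx = u_x u_xx - u u_x` on `[0, T)` with
`u(0) = u₀`, and `ut` is its time derivative. -/
structure IsSolution (s : ℝ) (u₀ : SobolevH s) (T : EReal) (u ut : ℝ → SobolevH s) : Prop where
  pos : 0 < T
  initial : u 0 = u₀
  continuousOn : ContinuousOn u (timeInterval T)
  hasDeriv : ∀ t ∈ timeInterval T, HasDerivWithinAt u (ut t) (timeInterval T) t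
  continuousOn_deriv : ContinuousOn ut (timeInterval T)
  equation : ∀ t ∈ timeInterval T, ThetaZeroEq (u t).toL2 (ut t).toL2

/-! ### Maximal solutions of autonomous differential equations -/

/-! Inverting `1 - ∂ₓ²` turns the problem into `u' = F u` with `F u = (1 - ∂ₓ²)⁻¹ ∂ₓ (u_x²/2 -
u²/2)`. For `s > 3/2` no derivative is lost: `u_x` lies in `H^{s-1}`, an algebra because `s - 1 >
1/2`, and `(1 - ∂ₓ²)⁻¹ ∂ₓ` gains one derivative. So `F` is quadratic and bounded on `H^s`, hence
Lipschitz on balls (`lipschitzOnBalls_thetaField`), and the claims are those of the theory of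
ordinary differential equations in a Banach space.

The local existence time depends only on a bound for the data
(`LipschitzOnBalls.exists_forwardSolution`); uniqueness glues all solutions into a maximal one,
whose norm must tend to infinity at a finite end time. Continuous dependence is a Grönwall estimate.

The bound for `F` is proved in the variable `f = (1 + (2πξ)²)^{s/2} û`, where `F` is a bilinear
integral operator on `L²`. By Cauchy–Schwarz it suffices that the kernel be square integrable in
`η`, uniformly in `ξ` (`eLpNorm_kernelConv_le`, `lintegral_thetaKernel_le`). Real-valuedness becomes
Hermitian symmetry of `f`, a closed condition that the kernel preserves.

Finally `thetaZeroEq_iff` identifies the weak equation with `w = F u`: testing against Fourier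
transforms of Schwartz functions shows that `F u` satisfies it, and `1 - ∂ₓ²` maps the Schwartz
space onto itself, so nothing else does. -/

lemma timeInterval_coe (T : ℝ) : timeInterval (T : EReal) = Ico 0 T := by
  ext t; simp [timeInterval]

lemma timeInterval_mono {S T : EReal} (h : S ≤ T) : timeInterval S ⊆ timeInterval T :=
  fun _ ht => ⟨ht.1, ht.2.trans_le h⟩

lemma Icc_subset_timeInterval {T : EReal} {τ : ℝ} (h : (τ : EReal) < T) :
    Icc 0 τ ⊆ timeInterval T :=
  fun _ ht => ⟨ht.1, (EReal.coe_le_coe_iff.2 ht.2).trans_lt h⟩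

lemma setOf_coe_lt_mem_nhds {S : EReal} {t : ℝ} (h : (t : EReal) < S) :
    {r : ℝ | (r : EReal) < S} ∈ 𝓝 t :=
  (isOpen_Iio.preimage continuous_coe_real_ereal).mem_nhds h

lemma timeInterval_mem_nhdsWithin {S : EReal} (T : EReal) {t : ℝ} (h : (t : EReal) < S) :
    timeInterval S ∈ 𝓝[timeInterval T] t := by
  filter_upwards [self_mem_nhdsWithin, mem_nhdsWithin_of_mem_nhds (setOf_coe_lt_mem_nhds h)]
    with r hr hr' using ⟨hr.1, hr'⟩

lemma timeInterval_mem_nhdsWithin_Ici {S : EReal} {t : ℝ} (ht : t ∈ timeInterval S) :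
    timeInterval S ∈ 𝓝[Ici t] t := by
  filter_upwards [self_mem_nhdsWithin, mem_nhdsWithin_of_mem_nhds (setOf_coe_lt_mem_nhds ht.2)]
    with r hr hr' using ⟨ht.1.trans hr, hr'⟩

/-- A function is Lipschitz on bounded sets. -/
def LipschitzOnBalls {E : Type*} [NormedAddCommGroup E] (F : E → E) : Prop :=
  ∀ R : ℝ, ∃ K : NNReal, LipschitzOnWith K F (Metric.closedBall 0 R)

lemma LipschitzOnBalls.continuous {E : Type*} [NormedAddCommGroup E] {F : E → E}
    (hF : LipschitzOnBalls F) : Continuous F := by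
  refine continuous_iff_continuousAt.2 fun x => ?_
  obtain ⟨K, hK⟩ := hF (‖x‖ + 1)
  exact hK.continuousOn.continuousAt (Metric.closedBall_mem_nhds_of_mem (by simp))

/-- `u` solves `u' = F u` on `[0, T)` with `u 0 = x`. -/
structure IsForwardSolution {E : Type*} [NormedAddCommGroup E] [NormedSpace ℝ E] (F : E → E)
    (x : E) (T : EReal) (u : ℝ → E) : Prop where
  pos : 0 < T
  initial : u 0 = x
  hasDeriv : ∀ t ∈ timeInterval T, HasDerivWithinAt u (F (u t)) (timeInterval T) t

section ODE

variable {E : Type*} [NormedAddCommGroup E] [NormedSpace ℝ E] {F : E → E} {x y : E}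
  {S T : EReal} {u v : ℝ → E}

namespace IsForwardSolution

lemma continuousOn (hu : IsForwardSolution F x T u) : ContinuousOn u (timeInterval T) :=
  fun t ht => (hu.hasDeriv t ht).continuousWithinAt

lemma continuousOn_Icc (hu : IsForwardSolution F x T u) {τ : ℝ} (h : (τ : EReal) < T) :
    ContinuousOn u (Icc 0 τ) :=
  hu.continuousOn.mono (Icc_subset_timeInterval h)

lemma hasDerivWithinAt_Ici (hu : IsForwardSolution F x T u) {t : ℝ} (ht : t ∈ timeInterval T) :
    HasDerivWithinAt u (F (u t)) (Ici t) t :=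
  (hu.hasDeriv t ht).mono_of_mem_nhdsWithin (timeInterval_mem_nhdsWithin_Ici ht)

lemma exists_norm_le (hu : IsForwardSolution F x T u) {τ : ℝ} (h : (τ : EReal) < T) :
    ∃ M, ∀ t ∈ Icc 0 τ, ‖u t‖ ≤ M :=
  isCompact_Icc.exists_bound_of_continuousOn (hu.continuousOn_Icc h)

lemma mono (hu : IsForwardSolution F x T u) (hS : 0 < S) (h : S ≤ T) :
    IsForwardSolution F x S u :=
  ⟨hS, hu.initial, fun t ht => (hu.hasDeriv t (timeInterval_mono h ht)).mono (timeInterval_mono h)⟩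

lemma congr (hu : IsForwardSolution F x T u) (h : EqOn v u (timeInterval T)) :
    IsForwardSolution F x T v := by
  refine ⟨hu.pos, ?_, fun t ht => ?_⟩
  · rw [h ⟨le_rfl, by exact_mod_cast hu.pos⟩, hu.initial]
  · rw [h ht]
    exact (hu.hasDeriv t ht).congr h (h ht)

/-- Both solutions are bounded on the compact interval `[0, τ]`, so a single Lipschitz constant
serves for both there and Grönwall's uniqueness theorem applies. -/
lemma eqOn (hF : LipschitzOnBalls F) (hu : IsForwardSolution F x T u)
    (hv : IsForwardSolution F x T v) : EqOn u v (timeInterval T) := by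
  intro τ hτ
  obtain ⟨M, hM⟩ := hu.exists_norm_le hτ.2
  obtain ⟨N, hN⟩ := hv.exists_norm_le hτ.2
  obtain ⟨K, hK⟩ := hF (max M N)
  have hsub : Ico 0 τ ⊆ timeInterval T := Ico_subset_Icc_self.trans (Icc_subset_timeInterval hτ.2)
  refine ODE_solution_unique_of_mem_Icc_right (v := fun _ => F)
    (s := fun _ => Metric.closedBall 0 (max M N)) (K := K)
    (fun _ _ => hK) (hu.continuousOn_Icc hτ.2)
    (fun t ht => hu.hasDerivWithinAt_Ici (hsub ht)) (fun t ht => ?_) (hv.continuousOn_Icc hτ.2)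
    (fun t ht => hv.hasDerivWithinAt_Ici (hsub ht)) (fun t ht => ?_)
    (hu.initial.trans hv.initial.symm) ⟨hτ.1, le_rfl⟩
  · simpa using Or.inl (hM t (Ico_subset_Icc_self ht))
  · simpa using Or.inr (hN t (Ico_subset_Icc_self ht))

/-- A solution can be continued by a solution that starts from one of its values. -/
lemma exists_glue (hu : IsForwardSolution F x T u) {a ε : ℝ} (ha : a ∈ timeInterval T)
    (hv : IsForwardSolution F (u a) (ε : EReal) v) :
    ∃ w, IsForwardSolution F x ((a + ε : ℝ) : EReal) w := by
  have hε : 0 < ε := by exact_mod_cast hv.pos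
  have hv' := hv.hasDeriv
  rw [timeInterval_coe] at hv'
  set w : ℝ → E := fun t => if t ≤ a then u t else v (t - a) with hw
  have hwu : ∀ t, t ≤ a → w t = u t := fun t ht => if_pos ht
  have hwv : ∀ t, a ≤ t → w t = v (t - a) := by
    intro t ht
    rcases ht.eq_or_lt with rfl | h
    · rw [hwu _ le_rfl, sub_self, hv.initial]
    · exact if_neg h.not_ge
  have hL : ∀ t ∈ Icc 0 a, HasDerivWithinAt w (F (w t)) (Icc 0 a) t := by
    intro t ht
    rw [hwu t ht.2]
    exact ((hu.hasDeriv t (Icc_subset_timeInterval ha.2 ht)).mono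
      (Icc_subset_timeInterval ha.2)).congr (fun r hr => hwu r hr.2) (hwu t ht.2)
  have hR : ∀ t ∈ Ico a (a + ε), HasDerivWithinAt w (F (w t)) (Ico a (a + ε)) t := by
    intro t ht
    rw [hwv t ht.1]
    have h := hv' (t - a) ⟨by linarith [ht.1], by linarith [ht.2]⟩
    have h2 : HasDerivWithinAt (fun r => v (r - a)) (F (v (t - a))) (Ico a (a + ε)) t := by
      have hmaps : MapsTo (fun r => r - a) (Ico a (a + ε)) (Ico 0 ε) := fun r hr =>
        ⟨by linarith [hr.1], by linarith [hr.2]⟩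
      have := HasDerivWithinAt.scomp t h (((hasDerivAt_id t).sub_const a).hasDerivWithinAt
        (s := Ico a (a + ε))) hmaps
      simpa [Function.comp_def] using this
    exact h2.congr (fun r hr => hwv r hr.1) (hwv t ht.1)
  refine ⟨w, by exact_mod_cast add_pos_of_nonneg_of_pos ha.1 hε, ?_, ?_⟩
  · rw [hwu 0 ha.1, hu.initial]
  rw [timeInterval_coe]
  have hunion : Icc 0 a ∪ Ico a (a + ε) = Ico 0 (a + ε) := by
    ext t; simp only [mem_union, mem_Icc, mem_Ico]
    have := ha.1
    constructor
    · rintro (h | h) <;> constructor <;> linarith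
    · rintro h
      rcases le_total t a with h' | h'
      · exact Or.inl ⟨h.1, h'⟩
      · exact Or.inr ⟨h', h.2⟩
  intro t ht
  rcases lt_trichotomy t a with h | rfl | h
  · refine (hL t ⟨ht.1, h.le⟩).mono_of_mem_nhdsWithin ?_
    filter_upwards [self_mem_nhdsWithin, mem_nhdsWithin_of_mem_nhds (Iic_mem_nhds h)]
      with r hr hr' using ⟨hr.1, hr'⟩
  · rw [← hunion]
    -- At the junction both one-sided derivatives equal `F (w t)`, so they combine.
    exact (hL t ⟨ht.1, le_rfl⟩).union (hR t ⟨le_rfl, ht.2⟩)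
  · refine (hR t ⟨h.le, ht.2⟩).mono_of_mem_nhdsWithin ?_
    filter_upwards [self_mem_nhdsWithin, mem_nhdsWithin_of_mem_nhds (Ici_mem_nhds h)]
      with r hr hr' using ⟨hr', hr.2⟩

end IsForwardSolution

/-- Picard–Lindelöf on the unit ball around `x`. All these balls lie in the ball of radius `R + 1`,
where `F` has one bound and one Lipschitz constant; hence the time is uniform in `x`. -/
lemma LipschitzOnBalls.exists_forwardSolution [CompleteSpace E] (hF : LipschitzOnBalls F) (R : ℝ) :
    ∃ ε : ℝ, 0 < ε ∧ ∀ x, ‖x‖ ≤ R → ∃ u, IsForwardSolution F x (ε : EReal) u := by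
  obtain ⟨K, hK⟩ := hF (R + 1)
  -- `L` may be negative when `R` is; `max L 0` below keeps the existence time positive in every
  -- case.
  set L : ℝ := K * (R + 1) + ‖F 0‖ with hL
  have hb : ∀ y, ‖y‖ ≤ R + 1 → ‖F y‖ ≤ max L 0 := by
    intro y hy
    have h0 : (0 : E) ∈ Metric.closedBall (0 : E) (R + 1) := by
      simpa using (norm_nonneg y).trans hy
    have h := hK.dist_le_mul y (by simpa using hy) 0 h0
    rw [dist_eq_norm, dist_zero_right] at h
    refine le_max_of_le_left ?_
    calc ‖F y‖ ≤ ‖F y - F 0‖ + ‖F 0‖ := norm_le_norm_sub_add _ _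
      _ ≤ K * ‖y‖ + ‖F 0‖ := by gcongr
      _ ≤ L := by rw [hL]; gcongr
  have hLpos : 0 < max L 0 + 1 := by positivity
  set ε : ℝ := 1 / (max L 0 + 1) with hε
  have hεpos : 0 < ε := by positivity
  refine ⟨ε, hεpos, fun x hx => ?_⟩
  have hsub : Metric.closedBall x 1 ⊆ Metric.closedBall (0 : E) (R + 1) := by
    refine Metric.closedBall_subset_closedBall' ?_
    rw [dist_zero_right]; linarith
  have hPL : IsPicardLindelof (fun _ => F) (tmin := 0) (tmax := ε) ⟨0, le_rfl, hεpos.le⟩ x 1 0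
      ⟨max L 0, le_max_right _ _⟩ K := by
    refine .of_time_independent (fun y hy => hb y ?_) (hK.mono ?_) ?_
    · simpa using hsub (by simpa using hy)
    · simpa using hsub
    · simp only [sub_zero, sub_self, NNReal.coe_one, NNReal.coe_zero]
      change max L 0 * _ ≤ _
      rw [max_eq_left hεpos.le, hε, mul_one_div, div_le_one hLpos]
      linarith
  obtain ⟨u, hu0, hu⟩ := hPL.exists_eq_forall_mem_Icc_hasDerivWithinAt₀
  refine ⟨u, by exact_mod_cast hεpos, hu0, ?_⟩
  rw [timeInterval_coe]
  exact fun t ht => (hu t (Ico_subset_Icc_self ht)).mono Ico_subset_Icc_self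

/-- The supremum of the times up to which a solution of `u' = F u`, `u 0 = x` exists. -/
noncomputable def maximalTime (F : E → E) (x : E) : EReal :=
  sSup {T | ∃ u, IsForwardSolution F x T u}

lemma IsForwardSolution.le_maximalTime (hu : IsForwardSolution F x T u) : T ≤ maximalTime F x :=
  le_sSup ⟨u, hu⟩

lemma LipschitzOnBalls.exists_maximal [CompleteSpace E] (hF : LipschitzOnBalls F) (x : E) :
    ∃ u, IsForwardSolution F x (maximalTime F x) u := by
  have hlt : ∀ t : ℝ, (t : EReal) < maximalTime F x →
      ∃ S, ∃ v, IsForwardSolution F x S v ∧ (t : EReal) < S := by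
    intro t ht
    obtain ⟨S, ⟨v, hv⟩, hS⟩ := lt_sSup_iff.1 ht
    exact ⟨S, v, hv, hS⟩
  choose! S v hv hS using hlt
  -- By uniqueness the diagonal `v r r` coincides near `t` with the single solution `v t`, and
  -- inherits its derivative.
  have key : ∀ t ∈ timeInterval (maximalTime F x), ∀ r ∈ timeInterval (S t), v r r = v t r := by
    intro t ht r hr
    have hrT : (r : EReal) < maximalTime F x := hr.2.trans_le (hv t ht.2).le_maximalTime
    have hpos : 0 < min (S r) (S t) := lt_min (hv r hrT).pos (hv t ht.2).pos
    exact ((hv r hrT).mono hpos (min_le_left _ _)).eqOn hF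
      ((hv t ht.2).mono hpos (min_le_right _ _)) ⟨hr.1, lt_min (hS r hrT) hr.2⟩
  obtain ⟨ε, hε, hloc⟩ := hF.exists_forwardSolution ‖x‖
  obtain ⟨w, hw⟩ := hloc x le_rfl
  have hpos : 0 < maximalTime F x := hw.pos.trans_le hw.le_maximalTime
  have h0 : (0 : ℝ) ∈ timeInterval (maximalTime F x) := ⟨le_rfl, by exact_mod_cast hpos⟩
  refine ⟨fun t => v t t, hpos, (hv 0 h0.2).initial, fun t ht => ?_⟩
  have hmem := hS t ht.2
  refine ((hv t ht.2).hasDeriv t ⟨ht.1, hmem⟩).mono_of_mem_nhdsWithin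
    (timeInterval_mem_nhdsWithin _ hmem) |>.congr_of_eventuallyEq ?_ rfl
  filter_upwards [timeInterval_mem_nhdsWithin _ hmem] with r hr using key t ht r hr

/-- The norm of a maximal solution that exists for a finite time only tends to infinity. -/
lemma LipschitzOnBalls.tendsto_norm_atTop [CompleteSpace E] (hF : LipschitzOnBalls F)
    (hu : IsForwardSolution F x (maximalTime F x) u) {τ : ℝ} (hτ : maximalTime F x = τ) :
    Tendsto (fun t => ‖u t‖) (𝓝[<] τ) atTop := by
  have hτ0 : 0 < τ := by exact_mod_cast hτ ▸ hu.pos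
  refine tendsto_atTop.2 fun R => ?_
  obtain ⟨ε, hε, hloc⟩ := hF.exists_forwardSolution R
  filter_upwards [Ioo_mem_nhdsLT (show max 0 (τ - ε) < τ by simp [hτ0, hε])] with t ht
  -- A norm below `R` at this one time `t > τ - ε` would allow a continuation past `τ`. As this
  -- excludes every such `t`, the norm has limit infinity, not merely an infinite upper limit.
  by_contra! hR
  obtain ⟨v, hv⟩ := hloc (u t) hR.le
  have ht0 : 0 ≤ t := (le_max_left _ _).trans ht.1.le
  obtain ⟨w, hw⟩ := hu.exists_glue (a := t)
    ⟨ht0, by rw [hτ]; exact_mod_cast ht.2⟩ hv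
  have h := hw.le_maximalTime
  rw [hτ, EReal.coe_le_coe_iff] at h
  linarith [(le_max_right _ _).trans_lt ht.1]

/-- Two solutions that start close to each other stay close, as long as both exist. -/
lemma IsForwardSolution.norm_sub_le (hu : IsForwardSolution F x T u)
    (hv : IsForwardSolution F y T v) {M τ d : ℝ} {K : NNReal} (hτ : (τ : EReal) < T)
    (hM : ∀ t ∈ Icc 0 τ, ‖u t‖ ≤ M) (hK : LipschitzOnWith K F (Metric.closedBall 0 (M + 1)))
    (hd : 0 < d) (hxy : ‖y - x‖ ≤ d) (hdτ : d * Real.exp ((K + 1) * τ) ≤ 1) :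
    ∀ t ∈ Icc 0 τ, ‖v t - u t‖ ≤ d * Real.exp ((K + 1) * t) := by
  have hsub : Ico 0 τ ⊆ timeInterval T := Ico_subset_Icc_self.trans (Icc_subset_timeInterval hτ)
  -- The barrier `d * exp ((K + 1) * t)` needs checking only where it is touched; there the distance
  -- is at most `1`, so `v t` lies in the ball on which `K` is valid. The rate `K + 1` makes the
  -- required inequality strict.
  refine image_norm_le_of_norm_deriv_right_lt_deriv_boundary (f := fun t => v t - u t)
    (f' := fun t => F (v t) - F (u t))
    (B' := fun t => d * (Real.exp ((K + 1) * t) * (K + 1)))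
    ((hv.continuousOn_Icc hτ).sub (hu.continuousOn_Icc hτ))
    (fun t ht => (hv.hasDerivWithinAt_Ici (hsub ht)).sub (hu.hasDerivWithinAt_Ici (hsub ht)))
    (by simpa [hu.initial, hv.initial] using hxy) (fun t => ?_) (fun t ht heq => ?_)
  · have h := (((hasDerivAt_id t).const_mul ((K : ℝ) + 1)).exp).const_mul d
    simpa using h
  · have hut := hM t (Ico_subset_Icc_self ht)
    have hle : ‖v t - u t‖ ≤ 1 := by
      rw [heq]
      refine le_trans ?_ hdτ
      gcongr
      exact ht.2.le
    have hvt : ‖v t‖ ≤ M + 1 := by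
      calc ‖v t‖ ≤ ‖v t - u t‖ + ‖u t‖ := norm_le_norm_sub_add _ _
        _ ≤ M + 1 := by linarith
    have h := hK.dist_le_mul (v t) (by simpa using hvt) (u t) (by simp; linarith)
    rw [dist_eq_norm, dist_eq_norm, heq] at h
    refine h.trans_lt ?_
    have := Real.exp_pos ((K + 1) * t)
    nlinarith [mul_pos hd this]

lemma LipschitzOnBalls.continuous_dependence [CompleteSpace E] (hF : LipschitzOnBalls F)
    {U : E → ℝ → E} (hU : ∀ x, IsForwardSolution F x (maximalTime F x) (U x))
    {τ : ℝ} (hτ : (τ : EReal) < maximalTime F x) :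
    (∀ᶠ y in 𝓝 x, (τ : EReal) < maximalTime F y) ∧
      TendstoUniformlyOn U (U x) (𝓝 x) (Icc 0 τ) ∧
      TendstoUniformlyOn (fun y t => F (U y t)) (fun t => F (U x t)) (𝓝 x) (Icc 0 τ) := by
  obtain ⟨M, hM⟩ := (hU x).exists_norm_le hτ
  obtain ⟨K, hK⟩ := hF (M + 1)
  set C := Real.exp ((K + 1) * τ) with hC
  have hC1 : 0 < C := Real.exp_pos _
  have hexp : ∀ t ≤ τ, Real.exp ((K + 1) * t) ≤ C := fun t ht => by rw [hC]; gcongr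
  -- The radius `C⁻¹` keeps the distance to `U x` at most `1`. A solution ending at some `σ ≤ τ`
  -- would then stay in the ball of radius `M + 1`, against the blow-up of its norm.
  have hlt : ∀ y, ‖y - x‖ ≤ C⁻¹ → (τ : EReal) < maximalTime F y := by
    intro y hy
    by_contra! hle
    obtain ⟨σ, hσ⟩ : ∃ σ : ℝ, maximalTime F y = σ := by
      have hbot : maximalTime F y ≠ ⊥ := ((bot_lt_iff_ne_bot.1 (bot_le.trans_lt (hU y).pos)))
      have htop : maximalTime F y ≠ ⊤ := (hle.trans_lt (EReal.coe_lt_top τ)).ne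
      exact ⟨_, (EReal.coe_toReal htop hbot).symm⟩
    have hστ : σ ≤ τ := by rw [hσ] at hle; exact_mod_cast hle
    have hσ0 : 0 < σ := by exact_mod_cast hσ ▸ (hU y).pos
    have h := (hF.tendsto_norm_atTop (hU y) hσ).eventually_gt_atTop (M + 1)
    obtain ⟨t, ht1, ht2⟩ := (h.and (Ioo_mem_nhdsLT hσ0)).exists
    have hty : (t : EReal) < maximalTime F y := by rw [hσ]; exact_mod_cast ht2.2
    have hsub : Icc 0 t ⊆ Icc 0 τ := Icc_subset_Icc_right (ht2.2.le.trans hστ)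
    have hd := (((hU x).mono (hU y).pos (hle.trans hτ.le))).norm_sub_le (hU y) hty
      (fun r hr => hM r (hsub hr)) hK (inv_pos.2 hC1) hy
      (by
        calc C⁻¹ * Real.exp ((K + 1) * t) ≤ C⁻¹ * C := by
              gcongr; exact hexp t (ht2.2.le.trans hστ)
          _ = 1 := inv_mul_cancel₀ hC1.ne') t ⟨ht2.1.le, le_rfl⟩
    have h1 : C⁻¹ * Real.exp ((K + 1) * t) ≤ 1 := by
      calc C⁻¹ * Real.exp ((K + 1) * t) ≤ C⁻¹ * C := by
            gcongr; exact hexp t (ht2.2.le.trans hστ)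
        _ = 1 := inv_mul_cancel₀ hC1.ne'
    have h2 := hM t (hsub ⟨ht2.1.le, le_rfl⟩)
    linarith [norm_le_norm_sub_add (U y t) (U x t)]
  have hclose : ∀ d, 0 < d → d ≤ C⁻¹ → ∀ y, ‖y - x‖ ≤ d → ∀ t ∈ Icc 0 τ,
      ‖U y t - U x t‖ ≤ d * C := by
    intro d hd hdC y hy t ht
    have hpos : 0 < min (maximalTime F x) (maximalTime F y) := lt_min (hU x).pos (hU y).pos
    refine (((hU x).mono hpos (min_le_left _ _)).norm_sub_le ((hU y).mono hpos (min_le_right _ _))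
      (lt_min hτ (hlt y (hy.trans hdC))) hM hK hd hy ?_ t ht).trans ?_
    · calc d * C ≤ C⁻¹ * C := by gcongr
        _ = 1 := inv_mul_cancel₀ hC1.ne'
    · gcongr; exact hexp t ht.2
  have hnear : ∀ d, 0 < d → ∀ᶠ y in 𝓝 x, ‖y - x‖ ≤ d := fun d hd => by
    filter_upwards [Metric.closedBall_mem_nhds x hd] with y hy
    simpa [dist_eq_norm] using hy
  refine ⟨(hnear _ (inv_pos.2 hC1)).mono hlt, ?_, ?_⟩
  · refine Metric.tendstoUniformlyOn_iff.2 fun ε hε => ?_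
    set d := min C⁻¹ (ε / (2 * C)) with hd
    have hdpos : 0 < d := lt_min (inv_pos.2 hC1) (by positivity)
    filter_upwards [hnear d hdpos] with y hy t ht
    rw [dist_comm, dist_eq_norm]
    refine (hclose d hdpos (min_le_left _ _) y hy t ht).trans_lt ?_
    calc d * C ≤ ε / (2 * C) * C := by gcongr; exact min_le_right _ _
      _ = ε / 2 := by field_simp
      _ < ε := by linarith
  · refine Metric.tendstoUniformlyOn_iff.2 fun ε hε => ?_
    -- `K + 1` rather than `K`, since `K` may vanish.
    set d := min C⁻¹ (ε / (2 * C * (K + 1))) with hd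
    have hdpos : 0 < d := lt_min (inv_pos.2 hC1) (by positivity)
    filter_upwards [hnear d hdpos] with y hy t ht
    have h := hclose d hdpos (min_le_left _ _) y hy t ht
    have h1 : d * C ≤ 1 := by
      calc d * C ≤ C⁻¹ * C := by gcongr; exact min_le_left _ _
        _ = 1 := inv_mul_cancel₀ hC1.ne'
    have hux := hM t ht
    have hL := hK.dist_le_mul (U y t) (by simp; linarith [norm_le_norm_sub_add (U y t) (U x t)])
      (U x t) (by simp; linarith)
    rw [dist_comm]
    refine hL.trans_lt ?_
    rw [dist_eq_norm]
    calc K * ‖U y t - U x t‖ ≤ (K + 1) * (d * C) := by gcongr; linarith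
      _ ≤ (K + 1) * (ε / (2 * C * (K + 1)) * C) := by gcongr; exact min_le_right _ _
      _ = ε / 2 := by field_simp
      _ < ε := by linarith

end ODE

/-! ### The Fourier transform on `L²(ℝ)` tested against Schwartz functions -/

lemma integral_fourier_mul_schwartz (g : Lp ℂ 2 (volume : Measure ℝ)) (φ : 𝓢(ℝ, ℂ)) :
    ∫ ξ, (𝓕 g : Lp ℂ 2 (volume : Measure ℝ)) ξ * φ ξ = ∫ x, g x * 𝓕 φ x := by
  have h := congrArg (fun T : 𝓢'(ℝ, ℂ) => T φ) (Lp.fourier_toTemperedDistribution_eq g)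
  simp only [TemperedDistribution.fourier_apply, Lp.toTemperedDistribution_apply,
    smul_eq_mul] at h
  simpa only [mul_comm] using h.symm

lemma ae_eq_of_forall_integral_mul_schwartz {f g : ℝ → ℂ} (hf : LocallyIntegrable f)
    (hg : LocallyIntegrable g) (h : ∀ φ : 𝓢(ℝ, ℂ), ∫ x, f x * φ x = ∫ x, g x * φ x) :
    f =ᵐ[volume] g := by
  refine ae_eq_of_integral_contDiff_smul_eq hf hg fun φ hφ hc => ?_
  have hc' : HasCompactSupport (Complex.ofRealCLM ∘ φ) := hc.comp_left rfl
  have hφ' : ContDiff ℝ (⊤ : ℕ∞) (Complex.ofRealCLM ∘ φ) := by fun_prop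
  have := h (hc'.toSchwartzMap hφ')
  simp only [Complex.real_smul, mul_comm (Complex.ofReal _)]
  exact this

lemma ae_eq_of_forall_integral_mul_real_schwartz {f g : ℝ → ℝ} (hf : LocallyIntegrable f)
    (hg : LocallyIntegrable g) (h : ∀ φ : 𝓢(ℝ, ℝ), ∫ x, f x * φ x = ∫ x, g x * φ x) :
    f =ᵐ[volume] g := by
  refine ae_eq_of_integral_contDiff_smul_eq hf hg fun φ hφ hc => ?_
  have := h (hc.toSchwartzMap hφ)
  simp only [smul_eq_mul, mul_comm (φ _)]
  exact this

lemma Lp.locallyIntegrable_two {E : Type*} [NormedAddCommGroup E]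
    (f : Lp E 2 (volume : Measure ℝ)) : LocallyIntegrable f :=
  (Lp.memLp f).locallyIntegrable (by norm_num)

lemma integral_fourierInv_mul_schwartz {f : ℝ → ℂ} (hf : Integrable f) (φ : 𝓢(ℝ, ℂ)) :
    ∫ x, 𝓕⁻ f x * 𝓕 φ x = ∫ ξ, f ξ * φ ξ := by
  -- The pairing `-⟨x, ξ⟩` makes the Fubini identity one for the inverse transform.
  have h := VectorFourier.integral_fourierIntegral_smul_eq_flip (L := -innerₗ ℝ) (μ := volume)
    (ν := volume) Real.continuous_fourierChar 
    (show Continuous fun p : ℝ × ℝ => -inner ℝ p.1 p.2 from continuous_inner.neg) hf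
    (SchwartzMap.integrable (𝓕 φ))
  have hinv : 𝓕⁻ ((𝓕 φ : 𝓢(ℝ, ℂ)) : ℝ → ℂ) = φ := by
    rw [← SchwartzMap.fourierInv_coe]; simp
  refine h.trans (integral_congr_ae (ae_of_all _ fun ξ => ?_))
  change f ξ * _ = f ξ * _
  congr 1
  conv_rhs => rw [← hinv]
  rw [Real.fourierInv_eq]
  simp [VectorFourier.fourierIntegral, mul_comm]

/-- An `L²` function whose Fourier transform is integrable is given by the inversion formula. -/
lemma Lp.ae_eq_fourierInv {g : Lp ℂ 2 (volume : Measure ℝ)}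
    (h : Integrable (𝓕 g : Lp ℂ 2 (volume : Measure ℝ))) :
    g =ᵐ[volume] 𝓕⁻ ((𝓕 g : Lp ℂ 2 (volume : Measure ℝ)) : ℝ → ℂ) := by
  have hcont : Continuous (𝓕⁻ ((𝓕 g : Lp ℂ 2 (volume : Measure ℝ)) : ℝ → ℂ)) := by
    rw [Real.fourierInv_eq_fourier_comp_neg]
    exact VectorFourier.fourierIntegral_continuous Real.continuous_fourierChar
      continuous_inner h.comp_neg
  refine ae_eq_of_forall_integral_mul_schwartz (Lp.locallyIntegrable_two g)
    hcont.locallyIntegrable fun φ => ?_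
  have hφ : 𝓕 (𝓕⁻ φ) = φ := by simp
  rw [← hφ, ← integral_fourier_mul_schwartz, integral_fourierInv_mul_schwartz h]

/-! ### Hermitian symmetry -/

/-- The reflection `f ↦ conj (f (-·))` on `L²(ℝ; ℂ)`. -/
noncomputable def conjReflect (f : Lp ℂ 2 (volume : Measure ℝ)) : Lp ℂ 2 (volume : Measure ℝ) :=
  Complex.conjCLE.toContinuousLinearMap.compLpL 2 volume
    (Lp.compMeasurePreserving Neg.neg (Measure.measurePreserving_neg volume) f)

lemma ae_comp_neg {p : ℝ → Prop} (h : ∀ᵐ x, p x) : ∀ᵐ x : ℝ, p (-x) :=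
  (Measure.measurePreserving_neg (volume : Measure ℝ)).quasiMeasurePreserving.ae h

lemma ae_comp_sub {p : ℝ → Prop} (h : ∀ᵐ x, p x) (ξ : ℝ) : ∀ᵐ x : ℝ, p (ξ - x) :=
  (quasiMeasurePreserving_sub_left (volume : Measure ℝ) ξ).ae h

lemma coeFn_conjReflect (f : Lp ℂ 2 (volume : Measure ℝ)) :
    conjReflect f =ᵐ[volume] fun ξ => starRingEnd ℂ (f (-ξ)) := by
  filter_upwards [Complex.conjCLE.toContinuousLinearMap.coeFn_compLpL (p := 2) (μ := volume)
    (Lp.compMeasurePreserving Neg.neg (Measure.measurePreserving_neg volume) f),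
    Lp.coeFn_compMeasurePreserving f (Measure.measurePreserving_neg (volume : Measure ℝ))]
    with ξ h1 h2
  rw [conjReflect, h1, h2]
  rfl

lemma continuous_conjReflect : Continuous conjReflect :=
  (ContinuousLinearMap.continuous _).comp
    (Lp.isometry_compMeasurePreserving (Measure.measurePreserving_neg volume)).continuous

lemma conjReflect_eq_self_iff {f : Lp ℂ 2 (volume : Measure ℝ)} :
    conjReflect f = f ↔ ∀ᵐ ξ, f (-ξ) = starRingEnd ℂ (f ξ) := by
  constructor
  · intro h
    have h1 := coeFn_conjReflect f
    rw [h] at h1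
    filter_upwards [h1] with ξ hξ
    rw [hξ, Complex.conj_conj]
  · intro h
    refine Lp.ext ((coeFn_conjReflect f).trans ?_)
    filter_upwards [h] with ξ hξ
    rw [hξ, Complex.conj_conj]

/-- The Schwartz function `ξ ↦ conj (φ (-ξ))`. -/
noncomputable def SchwartzMap.conjNeg (φ : 𝓢(ℝ, ℂ)) : 𝓢(ℝ, ℂ) :=
  SchwartzMap.postcompCLM (𝕜 := ℝ) Complex.conjCLE.toContinuousLinearMap
    (SchwartzMap.compCLMOfContinuousLinearEquiv ℝ (ContinuousLinearEquiv.neg ℝ) φ)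

lemma SchwartzMap.conjNeg_apply (φ : 𝓢(ℝ, ℂ)) (ξ : ℝ) :
    φ.conjNeg ξ = starRingEnd ℂ (φ (-ξ)) := rfl

lemma SchwartzMap.fourier_conjNeg (φ : 𝓢(ℝ, ℂ)) (x : ℝ) :
    𝓕 φ.conjNeg x = starRingEnd ℂ (𝓕 φ x) := by
  rw [SchwartzMap.fourier_coe, SchwartzMap.fourier_coe, Real.fourier_eq', Real.fourier_eq',
    ← integral_conj, ← integral_neg_eq_self]
  refine integral_congr_ae (ae_of_all _ fun ξ => ?_)
  simp [SchwartzMap.conjNeg_apply, ← Complex.exp_conj, Complex.conj_ofNat]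

/-- Tested against Schwartz functions, the identity is moved onto the test function, where it is a
change of variables. -/
lemma fourier_conj (g : Lp ℂ 2 (volume : Measure ℝ)) :
    𝓕 (Complex.conjCLE.toContinuousLinearMap.compLpL 2 volume g) = conjReflect (𝓕 g) := by
  refine Lp.ext (ae_eq_of_forall_integral_mul_schwartz (Lp.locallyIntegrable_two _)
    (Lp.locallyIntegrable_two _) fun φ => ?_)
  rw [integral_fourier_mul_schwartz]
  have h1 : ∫ x, (Complex.conjCLE.toContinuousLinearMap.compLpL 2 volume g) x * 𝓕 φ x =
      starRingEnd ℂ (∫ x, g x * 𝓕 φ.conjNeg x) := by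
    rw [← integral_conj]
    refine integral_congr_ae ?_
    filter_upwards [Complex.conjCLE.toContinuousLinearMap.coeFn_compLpL (p := 2) (μ := volume) g]
      with x hx
    rw [hx, SchwartzMap.fourier_conjNeg, map_mul, Complex.conj_conj]
    rfl
  rw [h1, ← integral_fourier_mul_schwartz, ← integral_conj, ← integral_neg_eq_self]
  refine integral_congr_ae ?_
  filter_upwards [coeFn_conjReflect (𝓕 g)] with x hx
  rw [hx, map_mul, SchwartzMap.conjNeg_apply, Complex.conj_conj, neg_neg]

lemma coeFn_complexify (u : Lp ℝ 2 (volume : Measure ℝ)) :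
    complexify u =ᵐ[volume] fun x => (u x : ℂ) :=
  Complex.ofRealCLM.coeFn_compLpL (p := 2) (μ := volume) u

lemma conjReflect_fourier_complexify (u : Lp ℝ 2 (volume : Measure ℝ)) :
    conjReflect (𝓕 (complexify u)) = 𝓕 (complexify u) := by
  rw [← fourier_conj]
  congr 1
  refine Lp.ext ?_
  filter_upwards [Complex.conjCLE.toContinuousLinearMap.coeFn_compLpL (p := 2) (μ := volume)
    (complexify u), coeFn_complexify u] with x h1 h2
  rw [h1, h2]
  exact Complex.conj_ofReal _

/-- The inverse transform is fixed by conjugation because the Fourier transform is injective, so it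
equals its real part. This is how real-valued functions are built from Fourier data. -/
lemma exists_fourier_complexify_eq {f : Lp ℂ 2 (volume : Measure ℝ)} (h : conjReflect f = f) :
    ∃ u : Lp ℝ 2 (volume : Measure ℝ), 𝓕 (complexify u) = f := by
  set g : Lp ℂ 2 (volume : Measure ℝ) := 𝓕⁻ f
  have hgf : 𝓕 g = f := FourierTransform.fourier_fourierInv_eq f
  have hg : Complex.conjCLE.toContinuousLinearMap.compLpL 2 volume g = g := by
    refine (Lp.fourierTransformₗᵢ ℝ ℂ).injective ?_
    exact (fourier_conj g).trans (by rw [hgf]; exact h.trans hgf.symm)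
  refine ⟨Complex.reCLM.compLpL 2 volume g, ?_⟩
  rw [← hgf]
  congr 1
  refine Lp.ext ?_
  have h1 := Complex.conjCLE.toContinuousLinearMap.coeFn_compLpL (p := 2) (μ := volume) g
  rw [hg] at h1
  filter_upwards [h1, coeFn_complexify (Complex.reCLM.compLpL 2 volume g),
    Complex.reCLM.coeFn_compLpL (p := 2) (μ := volume) g] with x h1 h2 h3
  rw [h2, h3]
  exact Complex.conj_eq_iff_re.1 h1.symm

/-! ### The weights -/

lemma one_add_sq_pos (ξ : ℝ) : 0 < 1 + (2 * Real.pi * ξ) ^ 2 := by positivity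

lemma besselWeight_pos (s ξ : ℝ) : 0 < besselWeight s ξ := by
  unfold besselWeight; positivity

lemma besselWeight_add (r s ξ : ℝ) :
    besselWeight (r + s) ξ = besselWeight r ξ * besselWeight s ξ := by
  rw [besselWeight, add_div, Real.rpow_add (one_add_sq_pos ξ)]; rfl

lemma besselWeight_two (ξ : ℝ) : besselWeight 2 ξ = 1 + (2 * Real.pi * ξ) ^ 2 := by
  simp [besselWeight]

lemma besselWeight_zero (ξ : ℝ) : besselWeight 0 ξ = 1 := by
  simp [besselWeight]

lemma besselWeight_neg (s ξ : ℝ) : besselWeight (-s) ξ = (besselWeight s ξ)⁻¹ := by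
  rw [besselWeight, neg_div, Real.rpow_neg (one_add_sq_pos ξ).le]; rfl

lemma besselWeight_comp_neg (s ξ : ℝ) : besselWeight s (-ξ) = besselWeight s ξ := by
  simp [besselWeight]

lemma continuous_besselWeight (s : ℝ) : Continuous (besselWeight s) :=
  Continuous.rpow_const (by fun_prop) fun ξ => Or.inl (one_add_sq_pos ξ).ne'

lemma one_le_besselWeight {s : ℝ} (hs : 0 ≤ s) (ξ : ℝ) : 1 ≤ besselWeight s ξ :=
  Real.one_le_rpow (by nlinarith [sq_nonneg (2 * Real.pi * ξ)]) (by positivity)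

lemma besselWeight_le_one {s : ℝ} (hs : s ≤ 0) (ξ : ℝ) : besselWeight s ξ ≤ 1 :=
  Real.rpow_le_one_of_one_le_of_nonpos (by nlinarith [sq_nonneg (2 * Real.pi * ξ)]) (by linarith)

lemma abs_le_besselWeight_one (ξ : ℝ) : |2 * Real.pi * ξ| ≤ besselWeight 1 ξ := by
  rw [besselWeight, ← Real.sqrt_eq_rpow]
  exact Real.abs_le_sqrt (by linarith)

lemma integrable_besselWeight_neg {r : ℝ} (hr : 1 < r) : Integrable (besselWeight (-r)) := by
  have h := (integrable_rpow_neg_one_add_norm_sq (E := ℝ) (μ := volume) (r := r)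
    (by simpa using hr)).comp_mul_left' (R := 2 * Real.pi) (by positivity)
  refine h.congr (ae_of_all _ fun ξ => ?_)
  simp only [besselWeight, Real.norm_eq_abs, sq_abs]

lemma memLp_besselWeight_neg {r : ℝ} (hr : 1 / 2 < r) : MemLp (besselWeight (-r)) 2 volume := by
  rw [memLp_two_iff_integrable_sq (continuous_besselWeight _).aestronglyMeasurable]
  refine (integrable_besselWeight_neg (r := 2 * r) (by linarith)).congr (ae_of_all _ fun ξ => ?_)
  simp only [sq]
  rw [← besselWeight_add]; ring_nf

/-! ### Completeness of `H^s(ℝ)` -/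

namespace SobolevH

lemma norm_def {s : ℝ} (u : SobolevH s) : ‖u‖ = ‖bessel s u‖ := rfl

/-- The Fourier transform of an element of `H^s(ℝ)`. -/
noncomputable def hat {s : ℝ} (u : SobolevH s) : Lp ℂ 2 (volume : Measure ℝ) :=
  𝓕 (complexify (toL2 u))

lemma coeFn_bessel {s : ℝ} (u : SobolevH s) :
    bessel s u =ᵐ[volume] fun ξ => (besselWeight s ξ : ℂ) * hat u ξ :=
  (memLp_weightedFourier u).coeFn_toLp

lemma hat_ae_eq {s : ℝ} (u : SobolevH s) :
    hat u =ᵐ[volume] fun ξ => (besselWeight (-s) ξ : ℂ) * bessel s u ξ := by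
  filter_upwards [coeFn_bessel u] with ξ hξ
  rw [hξ, ← mul_assoc, ← Complex.ofReal_mul, ← besselWeight_add, neg_add_cancel,
    besselWeight_zero, Complex.ofReal_one, one_mul]

lemma hat_neg_ae {s : ℝ} (u : SobolevH s) : ∀ᵐ ξ, hat u (-ξ) = starRingEnd ℂ (hat u ξ) :=
  conjReflect_eq_self_iff.1 (conjReflect_fourier_complexify _)

lemma conjReflect_bessel {s : ℝ} (u : SobolevH s) : conjReflect (bessel s u) = bessel s u := by
  rw [conjReflect_eq_self_iff]
  filter_upwards [coeFn_bessel u, ae_comp_neg (coeFn_bessel u), hat_neg_ae u] with ξ h1 h2 h3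
  rw [h1, h2, h3, map_mul, Complex.conj_ofReal, besselWeight_comp_neg]

/-- Dividing by the weight keeps `f` in `L²`, since the weight is at least `1`, and Hermitian, since
it is even. -/
lemma exists_bessel_eq {s : ℝ} (hs : 0 ≤ s) {f : Lp ℂ 2 (volume : Measure ℝ)}
    (hf : conjReflect f = f) : ∃ u : SobolevH s, bessel s u = f := by
  have hmem : MemLp (fun ξ => (besselWeight (-s) ξ : ℂ) * f ξ) 2 volume := by
    refine (Lp.memLp f).mono ((Complex.continuous_ofReal.comp
      (continuous_besselWeight _)).aestronglyMeasurable.mul (Lp.aestronglyMeasurable f))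
      (ae_of_all _ fun ξ => ?_)
    rw [norm_mul, Complex.norm_real, Real.norm_of_nonneg (besselWeight_pos _ _).le]
    exact mul_le_of_le_one_left (norm_nonneg _) (besselWeight_le_one (by linarith) ξ)
  obtain ⟨u, hu⟩ := exists_fourier_complexify_eq (f := hmem.toLp _) (by
    rw [conjReflect_eq_self_iff] at hf ⊢
    filter_upwards [hmem.coeFn_toLp, ae_comp_neg hmem.coeFn_toLp, hf] with ξ h1 h2 h3
    rw [h1, h2, h3, map_mul, Complex.conj_ofReal, besselWeight_comp_neg])
  have hw : weightedFourier s u =ᵐ[volume] f := by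
    filter_upwards [hmem.coeFn_toLp] with ξ hξ
    rw [weightedFourier, hu, hξ, ← mul_assoc, ← Complex.ofReal_mul, ← besselWeight_add,
      add_neg_cancel, besselWeight_zero, Complex.ofReal_one, one_mul]
  refine ⟨⟨u, (memLp_congr_ae hw).2 (Lp.memLp f)⟩, Lp.ext ?_⟩
  exact (MemLp.coeFn_toLp ((memLp_congr_ae hw).2 (Lp.memLp f))).trans hw

lemma isometry_bessel (s : ℝ) : Isometry (bessel s) :=
  AddMonoidHomClass.isometry_of_norm _ fun _ => rfl

/-- `bessel s` is an isometry onto the Hermitian functions, a closed subset of `L²`. -/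
lemma completeSpace {s : ℝ} (hs : 0 ≤ s) : CompleteSpace (SobolevH s) := by
  have hrange : range (bessel s) = {f | conjReflect f = f} := by
    ext f
    exact ⟨by rintro ⟨u, rfl⟩; exact conjReflect_bessel u, fun hf => exists_bessel_eq hs hf⟩
  rw [completeSpace_iff_isComplete_range (isometry_bessel s).isUniformInducing, hrange]
  exact (isClosed_eq continuous_conjReflect continuous_id).isComplete

/-- Cauchy–Schwarz: the function is the product of the weight of order `-(s - 1)`, square integrable
because `s - 1 > 1/2`, and of `bessel s u`. It makes the transforms of `u` and `u_x` integrable, so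
that squares become honest convolutions. -/
lemma integrable_besselWeight_mul_hat {s : ℝ} (hs : 3 / 2 < s) (u : SobolevH s) :
    Integrable fun ξ => (besselWeight 1 ξ : ℂ) * hat u ξ := by
  have h := ((memLp_besselWeight_neg (r := s - 1) (by linarith)).ofReal (K := ℂ)).integrable_mul
    (Lp.memLp (bessel s u))
  refine h.congr ?_
  filter_upwards [hat_ae_eq u] with ξ hξ
  rw [Pi.mul_apply, hξ, ← mul_assoc, ← Complex.ofReal_mul, ← besselWeight_add]
  rw [show 1 + -s = -(s - 1) by ring]
  rfl

end SobolevH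

/-! ### Bilinear integral operators on `L²(ℝ)` -/

/-- The function `ξ ↦ ∫ K(ξ, η) f(η) g(ξ - η) dη`. -/
noncomputable def kernelConv (K : ℝ → ℝ → ℂ) (f g : ℝ → ℂ) (ξ : ℝ) : ℂ :=
  ∫ η, K ξ η * (f η * g (ξ - η))

section KernelConv

variable {K : ℝ → ℝ → ℂ} {f g : ℝ → ℂ} {C : ℝ≥0∞}

lemma aestronglyMeasurable_kernelConv (hK : Continuous (Function.uncurry K))
    (hf : AEStronglyMeasurable f) (hg : AEStronglyMeasurable g) :
    AEStronglyMeasurable (kernelConv K f g) := by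
  have h := hf.convolution_integrand (ContinuousLinearMap.mul ℝ ℂ) hg
  exact (hK.aestronglyMeasurable.mul h).integral_prod_right'

lemma aestronglyMeasurable_mul_comp_sub (hf : AEStronglyMeasurable f)
    (hg : AEStronglyMeasurable g) (ξ : ℝ) : AEStronglyMeasurable fun η => f η * g (ξ - η) :=
  hf.mul (hg.comp_quasiMeasurePreserving (quasiMeasurePreserving_sub_left volume ξ))

/-- Tonelli's theorem and translation invariance. -/
lemma lintegral_lintegral_mul_comp_sub (hf : AEStronglyMeasurable f)
    (hg : AEStronglyMeasurable g) :
    ∫⁻ ξ, ∫⁻ η, ‖f η * g (ξ - η)‖ₑ ^ (2 : ℝ) =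
      (∫⁻ η, ‖f η‖ₑ ^ (2 : ℝ)) * ∫⁻ η, ‖g η‖ₑ ^ (2 : ℝ) := by
  have h := (hf.convolution_integrand (ContinuousLinearMap.mul ℝ ℂ) hg (μ := volume)).enorm.pow_const
    (2 : ℝ)
  rw [lintegral_lintegral_swap h]
  simp only [enorm_mul, ENNReal.mul_rpow_of_nonneg _ _ (show (0 : ℝ) ≤ 2 by norm_num)]
  rw [← lintegral_mul_const'' _ (hf.enorm.pow_const _)]
  refine lintegral_congr fun η => ?_
  have hgη : AEStronglyMeasurable (fun ξ => g (ξ - η)) := hg.comp_quasiMeasurePreserving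
    (measurePreserving_sub_right volume η).quasiMeasurePreserving
  rw [lintegral_const_mul'' _ (hgη.enorm.pow_const _),
    lintegral_sub_right_eq_self (fun ξ => ‖g ξ‖ₑ ^ (2 : ℝ)) η]

lemma lintegral_enorm_rpow_two_lt_top {f : ℝ → ℂ} (hf : MemLp f 2 volume) :
    ∫⁻ η, ‖f η‖ₑ ^ (2 : ℝ) < ∞ := by
  have := lintegral_rpow_enorm_lt_top_of_eLpNorm_lt_top two_ne_zero ENNReal.ofNat_ne_top hf.2
  simpa using this

lemma eLpNorm_two (f : ℝ → ℂ) :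
    eLpNorm f 2 volume = (∫⁻ η, ‖f η‖ₑ ^ (2 : ℝ)) ^ (1 / 2 : ℝ) := by
  rw [eLpNorm_eq_lintegral_rpow_enorm_toReal two_ne_zero ENNReal.ofNat_ne_top]
  simp

lemma ae_memLp_mul_comp_sub (hf : MemLp f 2 volume) (hg : MemLp g 2 volume) :
    ∀ᵐ ξ, MemLp (fun η => f η * g (ξ - η)) 2 volume := by
  have h := (hf.1.convolution_integrand (ContinuousLinearMap.mul ℝ ℂ) hg.1
    (μ := volume)).enorm.pow_const (2 : ℝ)
  have hfin := lintegral_lintegral_mul_comp_sub hf.1 hg.1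
  have hlt : ∫⁻ ξ, ∫⁻ η, ‖f η * g (ξ - η)‖ₑ ^ (2 : ℝ) ≠ ∞ := by
    rw [hfin]
    exact ENNReal.mul_ne_top (lintegral_enorm_rpow_two_lt_top hf).ne
      (lintegral_enorm_rpow_two_lt_top hg).ne
  filter_upwards [ae_lt_top' h.lintegral_prod_right' hlt] with ξ hξ
  refine ⟨aestronglyMeasurable_mul_comp_sub hf.1 hg.1 ξ, ?_⟩
  rw [eLpNorm_two]
  exact ENNReal.rpow_lt_top_of_nonneg (by norm_num) hξ.ne

lemma ae_integrable_kernelConv (hK : Continuous (Function.uncurry K))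
    (hKC : ∀ ξ, ∫⁻ η, ‖K ξ η‖ₑ ^ (2 : ℝ) ≤ C) (hC : C ≠ ∞)
    (hf : MemLp f 2 volume) (hg : MemLp g 2 volume) :
    ∀ᵐ ξ, Integrable fun η => K ξ η * (f η * g (ξ - η)) := by
  filter_upwards [ae_memLp_mul_comp_sub hf hg] with ξ hξ
  have hKξ : MemLp (K ξ) 2 volume := by
    refine ⟨(hK.comp (by fun_prop : Continuous fun η => (ξ, η))).aestronglyMeasurable, ?_⟩
    rw [eLpNorm_two]
    exact ENNReal.rpow_lt_top_of_nonneg (by norm_num) ((hKC ξ).trans_lt hC.lt_top).ne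
  exact hKξ.integrable_mul hξ

/-- Cauchy–Schwarz in `η` separates the kernel from `f η * g (ξ - η)`; integrating the square of the
latter over `ξ` and `η` gives exactly the product of the squared norms. -/
lemma eLpNorm_kernelConv_le (hK : Continuous (Function.uncurry K))
    (hKC : ∀ ξ, ∫⁻ η, ‖K ξ η‖ₑ ^ (2 : ℝ) ≤ C) (hf : AEStronglyMeasurable f)
    (hg : AEStronglyMeasurable g) :
    eLpNorm (kernelConv K f g) 2 volume ≤
      C ^ (1 / 2 : ℝ) * (eLpNorm f 2 volume * eLpNorm g 2 volume) := by
  have h2 : (0 : ℝ) ≤ 1 / 2 := by norm_num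
  simp only [eLpNorm_two]
  rw [← ENNReal.mul_rpow_of_nonneg _ _ h2, ← ENNReal.mul_rpow_of_nonneg _ _ h2]
  refine ENNReal.rpow_le_rpow ?_ h2
  rw [← lintegral_lintegral_mul_comp_sub hf hg, ← lintegral_const_mul'']
  swap
  · exact ((hf.convolution_integrand (ContinuousLinearMap.mul ℝ ℂ) hg
      (μ := volume)).enorm.pow_const (2 : ℝ)).lintegral_prod_right'
  refine lintegral_mono fun ξ => ?_
  have hle : ‖kernelConv K f g ξ‖ₑ ≤ (∫⁻ η, ‖K ξ η‖ₑ ^ (2 : ℝ)) ^ (1 / 2 : ℝ) *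
      (∫⁻ η, ‖f η * g (ξ - η)‖ₑ ^ (2 : ℝ)) ^ (1 / 2 : ℝ) := by
    refine (enorm_integral_le_lintegral_enorm _).trans ?_
    simp only [enorm_mul (K ξ _)]
    exact ENNReal.lintegral_mul_le_Lp_mul_Lq volume Real.HolderConjugate.two_two
      (hK.comp (by fun_prop : Continuous fun η => (ξ, η))).aestronglyMeasurable.enorm
      (aestronglyMeasurable_mul_comp_sub hf hg ξ).enorm
  calc ‖kernelConv K f g ξ‖ₑ ^ (2 : ℝ)
      ≤ ((∫⁻ η, ‖K ξ η‖ₑ ^ (2 : ℝ)) ^ (1 / 2 : ℝ) *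
        (∫⁻ η, ‖f η * g (ξ - η)‖ₑ ^ (2 : ℝ)) ^ (1 / 2 : ℝ)) ^ (2 : ℝ) := by gcongr
    _ = (∫⁻ η, ‖K ξ η‖ₑ ^ (2 : ℝ)) * ∫⁻ η, ‖f η * g (ξ - η)‖ₑ ^ (2 : ℝ) := by
      rw [ENNReal.mul_rpow_of_nonneg _ _ (by norm_num), ← ENNReal.rpow_mul, ← ENNReal.rpow_mul]
      norm_num
    _ ≤ C * ∫⁻ η, ‖f η * g (ξ - η)‖ₑ ^ (2 : ℝ) := by gcongr; exact hKC ξ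

lemma memLp_kernelConv (hK : Continuous (Function.uncurry K))
    (hKC : ∀ ξ, ∫⁻ η, ‖K ξ η‖ₑ ^ (2 : ℝ) ≤ C) (hC : C ≠ ∞) (hf : MemLp f 2 volume)
    (hg : MemLp g 2 volume) : MemLp (kernelConv K f g) 2 volume :=
  ⟨aestronglyMeasurable_kernelConv hK hf.1 hg.1,
    (eLpNorm_kernelConv_le hK hKC hf.1 hg.1).trans_lt
      (ENNReal.mul_lt_top (ENNReal.rpow_lt_top_of_nonneg (by norm_num) hC)
        (ENNReal.mul_lt_top hf.2 hg.2))⟩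

/-- The identity `B(f,f) - B(g,g) = B(f-g,f) + B(g,f-g)`, valid at those `ξ` where all four
integrals converge. -/
lemma kernelConv_self_sub (hK : Continuous (Function.uncurry K))
    (hKC : ∀ ξ, ∫⁻ η, ‖K ξ η‖ₑ ^ (2 : ℝ) ≤ C) (hC : C ≠ ∞) (hf : MemLp f 2 volume)
    (hg : MemLp g 2 volume) :
    kernelConv K f f - kernelConv K g g =ᵐ[volume]
      kernelConv K (f - g) f + kernelConv K g (f - g) := by
  filter_upwards [ae_integrable_kernelConv hK hKC hC hf hf,
    ae_integrable_kernelConv hK hKC hC hg hg, ae_integrable_kernelConv hK hKC hC (hf.sub hg) hf,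
    ae_integrable_kernelConv hK hKC hC hg (hf.sub hg)] with ξ h1 h2 h3 h4
  simp only [Pi.sub_apply, Pi.add_apply, kernelConv] at h3 h4 ⊢
  rw [← integral_sub h1 h2, ← integral_add h3 h4]
  congr 1 with η
  ring

/-- The map `f ↦ ∫ K(ξ, η) f(η) f(ξ - η) dη` on `L²` is Lipschitz on bounded sets. -/
lemma norm_kernelConv_sub_le (hK : Continuous (Function.uncurry K))
    (hKC : ∀ ξ, ∫⁻ η, ‖K ξ η‖ₑ ^ (2 : ℝ) ≤ C) (hC : C ≠ ∞) (f g : Lp ℂ 2 (volume : Measure ℝ)) :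
    ‖(memLp_kernelConv hK hKC hC (Lp.memLp f) (Lp.memLp f)).toLp _ -
      (memLp_kernelConv hK hKC hC (Lp.memLp g) (Lp.memLp g)).toLp _‖ ≤
      (C ^ (1 / 2 : ℝ)).toReal * (‖f‖ + ‖g‖) * ‖f - g‖ := by
  have hD : C ^ (1 / 2 : ℝ) ≠ ∞ := (ENNReal.rpow_lt_top_of_nonneg (by norm_num) hC).ne
  rw [← MemLp.toLp_sub, Lp.norm_toLp]
  have hsub := eLpNorm_congr_ae (p := 2) (Lp.coeFn_sub f g)
  have hle : eLpNorm (kernelConv K f f - kernelConv K g g) 2 volume ≤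
      C ^ (1 / 2 : ℝ) * (eLpNorm (f - g : Lp ℂ 2 (volume : Measure ℝ)) 2 volume *
        eLpNorm f 2 volume) +
      C ^ (1 / 2 : ℝ) * (eLpNorm g 2 volume *
        eLpNorm (f - g : Lp ℂ 2 (volume : Measure ℝ)) 2 volume) := by
    rw [eLpNorm_congr_ae (kernelConv_self_sub hK hKC hC (Lp.memLp f) (Lp.memLp g)), hsub]
    have hd := ((Lp.memLp f).sub (Lp.memLp g)).1
    refine (eLpNorm_add_le
      (aestronglyMeasurable_kernelConv hK hd (Lp.aestronglyMeasurable f))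
      (aestronglyMeasurable_kernelConv hK (Lp.aestronglyMeasurable g) hd) (by norm_num)).trans ?_
    exact add_le_add (eLpNorm_kernelConv_le hK hKC hd (Lp.aestronglyMeasurable f))
      (eLpNorm_kernelConv_le hK hKC (Lp.aestronglyMeasurable g) hd)
  have hf := Lp.eLpNorm_ne_top f
  have hg := Lp.eLpNorm_ne_top g
  have hfg := Lp.eLpNorm_ne_top (f - g)
  have h := ENNReal.toReal_mono (ENNReal.add_ne_top.2
    ⟨ENNReal.mul_ne_top hD (ENNReal.mul_ne_top hfg hf),
      ENNReal.mul_ne_top hD (ENNReal.mul_ne_top hg hfg)⟩) hle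
  rw [ENNReal.toReal_add (ENNReal.mul_ne_top hD (ENNReal.mul_ne_top hfg hf))
    (ENNReal.mul_ne_top hD (ENNReal.mul_ne_top hg hfg))] at h
  simp only [ENNReal.toReal_mul, ← Lp.norm_def] at h
  exact h.trans_eq (by ring)

end KernelConv

/-! ### The vector field -/

/-- The symbol `2πiξ` of `∂ₓ`. -/
noncomputable def derivSymbol (ξ : ℝ) : ℂ := ((2 * Real.pi * ξ : ℝ) : ℂ) * Complex.I

lemma norm_derivSymbol (ξ : ℝ) : ‖derivSymbol ξ‖ = |2 * Real.pi * ξ| := by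
  rw [derivSymbol, norm_mul, Complex.norm_real, Complex.norm_I, mul_one, Real.norm_eq_abs]

lemma derivSymbol_neg (ξ : ℝ) : derivSymbol (-ξ) = starRingEnd ℂ (derivSymbol ξ) := by
  simp [derivSymbol, Complex.conj_ofNat]

lemma continuous_derivSymbol : Continuous derivSymbol := by
  unfold derivSymbol; fun_prop

lemma derivSymbol_sq (ξ : ℝ) : derivSymbol ξ * derivSymbol ξ = -((2 * Real.pi * ξ : ℝ) : ℂ) ^ 2 := by
  rw [derivSymbol]
  linear_combination ((2 * Real.pi * ξ : ℝ) : ℂ) ^ 2 * Complex.I_mul_I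

/-- The kernel of `u ↦ (1 - ∂ₓ²)^{-1} ∂ₓ (u_x²/2 - u²/2)`, expressed through
`(1 + (2πξ)²)^{s/2} û`. -/
noncomputable def thetaKernel (s ξ η : ℝ) : ℂ :=
  besselWeight (s - 2) ξ * derivSymbol ξ * ((derivSymbol η * derivSymbol (ξ - η) - 1) / 2) *
    (besselWeight (-s) η * besselWeight (-s) (ξ - η))

lemma continuous_thetaKernel (s : ℝ) : Continuous (Function.uncurry (thetaKernel s)) := by
  have h1 := continuous_derivSymbol
  have h2 := fun r => Complex.continuous_ofReal.comp (continuous_besselWeight r)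
  unfold Function.uncurry thetaKernel
  exact ((((h2 (s - 2)).comp continuous_fst).mul (h1.comp continuous_fst)).mul
    ((((h1.comp continuous_snd).mul (h1.comp (continuous_fst.sub continuous_snd))).sub
      continuous_const).div_const 2)).mul (((h2 (-s)).comp continuous_snd).mul
    ((h2 (-s)).comp (continuous_fst.sub continuous_snd)))

/-- This symmetry is what makes the vector field preserve real-valuedness. -/
lemma thetaKernel_neg (s ξ η : ℝ) :
    thetaKernel s (-ξ) (-η) = starRingEnd ℂ (thetaKernel s ξ η) := by
  rw [thetaKernel, show -ξ - -η = -(ξ - η) by ring]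
  simp only [derivSymbol_neg, besselWeight_comp_neg, thetaKernel, map_mul, map_sub, map_div₀,
    Complex.conj_ofReal, map_one, Complex.conj_ofNat]

/-- Each factor `derivSymbol` costs one weight of order `1`: the outer one raises `s - 2` to `s -
1`, the inner ones raise `-s` to `-(s - 1)`. The factor `1/2` absorbs the summand `-1`. -/
lemma norm_thetaKernel_le (s ξ η : ℝ) : ‖thetaKernel s ξ η‖ ≤
    besselWeight (s - 1) ξ * (besselWeight (-(s - 1)) η * besselWeight (-(s - 1)) (ξ - η)) := by
  have hpos := besselWeight_pos
  have hn (r ζ : ℝ) : ‖(besselWeight r ζ : ℂ)‖ = besselWeight r ζ := by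
    rw [Complex.norm_real, Real.norm_of_nonneg (hpos r ζ).le]
  have e1 (ζ : ℝ) : besselWeight (s - 1) ζ = besselWeight (s - 2) ζ * besselWeight 1 ζ := by
    rw [← besselWeight_add]; ring_nf
  have e2 (ζ : ℝ) : besselWeight (-(s - 1)) ζ = besselWeight (-s) ζ * besselWeight 1 ζ := by
    rw [← besselWeight_add]; ring_nf
  have hone (ζ : ℝ) := one_le_besselWeight zero_le_one ζ
  have hmid : ‖(derivSymbol η * derivSymbol (ξ - η) - 1) / 2‖ ≤
      besselWeight 1 η * besselWeight 1 (ξ - η) := by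
    rw [norm_div, Complex.norm_ofNat, div_le_iff₀ two_pos]
    have h := norm_sub_le (derivSymbol η * derivSymbol (ξ - η)) 1
    rw [norm_mul, norm_derivSymbol, norm_derivSymbol, norm_one] at h
    have h1 := mul_le_mul (abs_le_besselWeight_one η) (abs_le_besselWeight_one (ξ - η))
      (abs_nonneg _) (hpos 1 η).le
    have h2 := one_le_mul_of_one_le_of_one_le (hone η) (hone (ξ - η))
    linarith
  rw [thetaKernel, norm_mul, norm_mul, norm_mul, norm_mul, hn, hn, hn, norm_derivSymbol]
  calc besselWeight (s - 2) ξ * |2 * Real.pi * ξ| *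
        ‖(derivSymbol η * derivSymbol (ξ - η) - 1) / 2‖ *
        (besselWeight (-s) η * besselWeight (-s) (ξ - η))
      ≤ besselWeight (s - 2) ξ * besselWeight 1 ξ *
        (besselWeight 1 η * besselWeight 1 (ξ - η)) *
        (besselWeight (-s) η * besselWeight (-s) (ξ - η)) := by
        have := abs_le_besselWeight_one ξ
        have h1 := hpos (s - 2) ξ
        have h2 := hpos (-s) η
        have h3 := hpos (-s) (ξ - η)
        have h4 := hpos 1 ξ
        gcongr
    _ = _ := by rw [e1, e2, e2]; ring

/-- With `a + b` the sum of the two frequencies, `1 + (a + b)² ≤ 4 (1 + max(a², b²))`. -/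
lemma besselWeight_two_mul_le {r : ℝ} (hr : 0 ≤ r) (ξ η : ℝ) :
    besselWeight (2 * r) ξ ≤ 4 ^ r * (besselWeight (2 * r) η + besselWeight (2 * r) (ξ - η)) := by
  have e (ζ : ℝ) : besselWeight (2 * r) ζ = (1 + (2 * Real.pi * ζ) ^ 2) ^ r := by
    rw [besselWeight, mul_div_cancel_left₀ _ two_ne_zero]
  simp only [e]
  set a := 2 * Real.pi * η with ha
  set b := 2 * Real.pi * (ξ - η) with hb
  have hab : 2 * Real.pi * ξ = a + b := by rw [ha, hb]; ring
  rw [hab]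
  have hA := Real.rpow_nonneg (show 0 ≤ 1 + a ^ 2 by positivity) r
  have hB := Real.rpow_nonneg (show 0 ≤ 1 + b ^ 2 by positivity) r
  rcases le_total (b ^ 2) (a ^ 2) with h | h
  · calc (1 + (a + b) ^ 2) ^ r ≤ (4 * (1 + a ^ 2)) ^ r := by
          gcongr; nlinarith [sq_nonneg (a - b)]
      _ = 4 ^ r * (1 + a ^ 2) ^ r := Real.mul_rpow (by norm_num) (by positivity)
      _ ≤ _ := by gcongr; linarith
  · calc (1 + (a + b) ^ 2) ^ r ≤ (4 * (1 + b ^ 2)) ^ r := by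
          gcongr; nlinarith [sq_nonneg (a - b)]
      _ = 4 ^ r * (1 + b ^ 2) ^ r := Real.mul_rpow (by norm_num) (by positivity)
      _ ≤ _ := by gcongr; linarith

/-- Dividing the preceding inequality by the product of the two weights leaves a sum of single
negative powers. Their integrals over `η` do not depend on `ξ`, and are finite as soon as `2(s - 1)
> 1`. -/
lemma norm_thetaKernel_sq_le {s : ℝ} (hs : 1 ≤ s) (ξ η : ℝ) : ‖thetaKernel s ξ η‖ ^ 2 ≤
    4 ^ (s - 1) * (besselWeight (-(2 * (s - 1))) η + besselWeight (-(2 * (s - 1))) (ξ - η)) := by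
  have hpos := besselWeight_pos
  have e (r ζ : ℝ) : besselWeight (2 * r) ζ = besselWeight r ζ ^ 2 := by
    rw [two_mul, besselWeight_add, sq]
  have hle := besselWeight_two_mul_le (show 0 ≤ s - 1 by linarith) ξ η
  have ha := hpos (2 * (s - 1)) η
  have hb := hpos (2 * (s - 1)) (ξ - η)
  calc ‖thetaKernel s ξ η‖ ^ 2
      ≤ (besselWeight (s - 1) ξ * (besselWeight (-(s - 1)) η *
          besselWeight (-(s - 1)) (ξ - η))) ^ 2 := by
        gcongr; exact norm_thetaKernel_le s ξ η
    _ = besselWeight (2 * (s - 1)) ξ * ((besselWeight (2 * (s - 1)) η)⁻¹ *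
          (besselWeight (2 * (s - 1)) (ξ - η))⁻¹) := by
        rw [e, e, e, besselWeight_neg, besselWeight_neg]; ring
    _ ≤ 4 ^ (s - 1) * (besselWeight (2 * (s - 1)) η + besselWeight (2 * (s - 1)) (ξ - η)) *
          ((besselWeight (2 * (s - 1)) η)⁻¹ * (besselWeight (2 * (s - 1)) (ξ - η))⁻¹) := by
        gcongr
    _ = _ := by
        rw [besselWeight_neg, besselWeight_neg]
        generalize besselWeight (2 * (s - 1)) η = a at *
        generalize besselWeight (2 * (s - 1)) (ξ - η) = b at *
        field_simp
        ring

/-- A bound for `∫ |thetaKernel s ξ η|² dη`. -/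
noncomputable def thetaBound (s : ℝ) : ℝ≥0∞ :=
  ENNReal.ofReal (4 ^ (s - 1)) *
    (2 * ∫⁻ η, ENNReal.ofReal (besselWeight (-(2 * (s - 1))) η))

lemma thetaBound_ne_top {s : ℝ} (hs : 3 / 2 < s) : thetaBound s ≠ ∞ :=
  ENNReal.mul_ne_top ENNReal.ofReal_ne_top (ENNReal.mul_ne_top ENNReal.ofNat_ne_top
    (integrable_besselWeight_neg (by linarith)).lintegral_lt_top.ne)

lemma lintegral_thetaKernel_le {s : ℝ} (hs : 1 ≤ s) (ξ : ℝ) :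
    ∫⁻ η, ‖thetaKernel s ξ η‖ₑ ^ (2 : ℝ) ≤ thetaBound s := by
  set W : ℝ → ℝ≥0∞ := fun η => ENNReal.ofReal (besselWeight (-(2 * (s - 1))) η) with hW
  have hWm : Measurable W := (continuous_besselWeight _).measurable.ennreal_ofReal
  have hpos := besselWeight_pos
  calc ∫⁻ η, ‖thetaKernel s ξ η‖ₑ ^ (2 : ℝ)
      ≤ ∫⁻ η, ENNReal.ofReal (4 ^ (s - 1)) * (W η + W (ξ - η)) := by
        refine lintegral_mono fun η => ?_
        rw [hW, ← ENNReal.ofReal_add (hpos _ _).le (hpos _ _).le,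
          ← ENNReal.ofReal_mul (by positivity), ← ofReal_norm,
          ENNReal.ofReal_rpow_of_nonneg (norm_nonneg _) (by norm_num), Real.rpow_two]
        exact ENNReal.ofReal_le_ofReal (norm_thetaKernel_sq_le hs ξ η)
    _ = thetaBound s := by
        rw [lintegral_const_mul _ (by fun_prop), lintegral_add_left hWm,
          lintegral_sub_left_eq_self W ξ, ← two_mul, thetaBound]

section

variable {s : ℝ}

lemma memLp_thetaConv (hs : 3 / 2 < s) (f : Lp ℂ 2 (volume : Measure ℝ)) :
    MemLp (kernelConv (thetaKernel s) f f) 2 volume :=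
  memLp_kernelConv (continuous_thetaKernel s) (lintegral_thetaKernel_le (by linarith))
    (thetaBound_ne_top hs) (Lp.memLp f) (Lp.memLp f)

lemma conjReflect_thetaConv (hs : 3 / 2 < s) {f : Lp ℂ 2 (volume : Measure ℝ)}
    (hf : conjReflect f = f) :
    conjReflect ((memLp_thetaConv hs f).toLp _) = (memLp_thetaConv hs f).toLp _ := by
  rw [conjReflect_eq_self_iff] at hf ⊢
  filter_upwards [(memLp_thetaConv hs f).coeFn_toLp, ae_comp_neg (memLp_thetaConv hs f).coeFn_toLp]
    with ξ h1 h2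
  rw [h1, h2, kernelConv, kernelConv, ← integral_conj, ← integral_neg_eq_self]
  refine integral_congr_ae ?_
  filter_upwards [hf, ae_comp_sub hf ξ] with η h3 h4
  rw [thetaKernel_neg, show -ξ - -η = -(ξ - η) by ring, h3, h4, map_mul, map_mul]

lemma exists_thetaField (hs : 3 / 2 < s) (u : SobolevH s) :
    ∃ w : SobolevH s, SobolevH.bessel s w = (memLp_thetaConv hs (SobolevH.bessel s u)).toLp _ :=
  SobolevH.exists_bessel_eq (by linarith)
    (conjReflect_thetaConv hs (SobolevH.conjReflect_bessel u))

/-- The vector field `u ↦ (1 - ∂ₓ²)^{-1} ∂ₓ (u_x²/2 - u²/2)` on `H^s(ℝ)`, `s > 3/2`. -/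
noncomputable def thetaField (hs : 3 / 2 < s) (u : SobolevH s) : SobolevH s :=
  (exists_thetaField hs u).choose

lemma bessel_thetaField (hs : 3 / 2 < s) (u : SobolevH s) :
    SobolevH.bessel s (thetaField hs u) =
      (memLp_thetaConv hs (SobolevH.bessel s u)).toLp _ :=
  (exists_thetaField hs u).choose_spec

lemma lipschitzOnBalls_thetaField (hs : 3 / 2 < s) : LipschitzOnBalls (thetaField hs) := by
  intro R
  set D := (thetaBound s ^ (1 / 2 : ℝ)).toReal with hD
  -- `D` bounds the bilinear form and `R + R` bounds `‖u‖ + ‖v‖`.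
  refine ⟨Real.toNNReal (D * (R + R)), LipschitzOnWith.of_dist_le_mul fun u hu v hv => ?_⟩
  rw [mem_closedBall_zero_iff] at hu hv
  rw [dist_eq_norm, dist_eq_norm, SobolevH.norm_def, map_sub, bessel_thetaField,
    bessel_thetaField]
  refine (norm_kernelConv_sub_le (continuous_thetaKernel s) (lintegral_thetaKernel_le (by linarith))
    (thetaBound_ne_top hs) _ _).trans ?_
  rw [← map_sub, ← SobolevH.norm_def, ← SobolevH.norm_def, ← SobolevH.norm_def]
  gcongr
  refine le_trans ?_ (Real.le_coe_toNNReal _)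
  have : 0 ≤ D := ENNReal.toReal_nonneg
  gcongr

end

/-! ### The weak equation on the Fourier side -/

lemma hasTemperateGrowth_derivSymbol : derivSymbol.HasTemperateGrowth := by
  unfold derivSymbol; fun_prop

lemma hasTemperateGrowth_besselWeight (s : ℝ) :
    (fun ξ => (besselWeight s ξ : ℂ)).HasTemperateGrowth := by
  have h1 := Function.hasTemperateGrowth_one_add_norm_sq_rpow ℝ (s / 2)
  have h2 : (fun ξ : ℝ => 2 * Real.pi * ξ).HasTemperateGrowth := by fun_prop
  have h3 : (besselWeight s).HasTemperateGrowth := by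
    have h : besselWeight s =
        (fun x : ℝ => (1 + ‖x‖ ^ 2) ^ (s / 2)) ∘ fun ξ => 2 * Real.pi * ξ := by
      ext ξ
      simp only [besselWeight, Function.comp_apply, Real.norm_eq_abs, sq_abs]
    rw [h]
    exact h1.comp h2
  fun_prop

lemma deriv_fourier_schwartz (ψ : 𝓢(ℝ, ℂ)) :
    deriv (𝓕 ψ : 𝓢(ℝ, ℂ)) =
      (𝓕 (SchwartzMap.smulLeftCLM ℂ (fun ξ => -derivSymbol ξ) ψ) : 𝓢(ℝ, ℂ)) := by
  have hg : (fun ξ => -derivSymbol ξ).HasTemperateGrowth := hasTemperateGrowth_derivSymbol.neg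
  have hx : Integrable fun x : ℝ => x • ψ x := by
    have h := SchwartzMap.integrable (μ := volume)
      (SchwartzMap.smulLeftCLM ℂ (fun x : ℝ => (x : ℂ)) ψ)
    refine h.congr (ae_of_all _ fun x => ?_)
    rw [SchwartzMap.smulLeftCLM_apply_apply (by fun_prop)]
    simp
  rw [SchwartzMap.fourier_coe, SchwartzMap.fourier_coe,
    Real.deriv_fourier (SchwartzMap.integrable ψ) hx]
  congr 1 with ξ
  rw [SchwartzMap.smulLeftCLM_apply_apply hg]
  simp only [derivSymbol, smul_eq_mul]
  push_cast
  ring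

lemma fourier_sub_deriv_deriv (ψ : 𝓢(ℝ, ℂ)) (x : ℝ) :
    (𝓕 ψ : 𝓢(ℝ, ℂ)) x - deriv (deriv (𝓕 ψ : 𝓢(ℝ, ℂ))) x =
      (𝓕 (SchwartzMap.smulLeftCLM ℂ (fun ξ => (besselWeight 2 ξ : ℂ)) ψ) : 𝓢(ℝ, ℂ)) x := by
  have hg : (fun ξ => -derivSymbol ξ).HasTemperateGrowth := hasTemperateGrowth_derivSymbol.neg
  rw [deriv_fourier_schwartz, deriv_fourier_schwartz]
  set ψ₂ := SchwartzMap.smulLeftCLM ℂ (fun ξ => -derivSymbol ξ)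
    (SchwartzMap.smulLeftCLM ℂ (fun ξ => -derivSymbol ξ) ψ) with hψ₂
  have h : SchwartzMap.smulLeftCLM ℂ (fun ξ => (besselWeight 2 ξ : ℂ)) ψ = ψ - ψ₂ := by
    ext ξ
    rw [SchwartzMap.smulLeftCLM_apply_apply (hasTemperateGrowth_besselWeight 2),
      sub_apply, hψ₂, SchwartzMap.smulLeftCLM_apply_apply hg,
      SchwartzMap.smulLeftCLM_apply_apply hg, besselWeight_two]
    simp only [smul_eq_mul]
    have := derivSymbol_sq ξ
    push_cast at this ⊢
    linear_combination ψ ξ * this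
  rw [h]
  exact congrArg (fun Θ : 𝓢(ℝ, ℂ) => Θ x)
    (map_sub (FourierTransform.fourierCLM ℂ 𝓢(ℝ, ℂ)) ψ ψ₂).symm

/-- The complex-valued Schwartz function underlying a real-valued one. -/
noncomputable def SchwartzMap.complexify (φ : 𝓢(ℝ, ℝ)) : 𝓢(ℝ, ℂ) :=
  SchwartzMap.postcompCLM (𝕜 := ℝ) Complex.ofRealCLM φ

lemma SchwartzMap.complexify_apply (φ : 𝓢(ℝ, ℝ)) (x : ℝ) : φ.complexify x = (φ x : ℂ) := rfl

lemma deriv_ofReal_comp {f : ℝ → ℝ} {x : ℝ} (hf : DifferentiableAt ℝ f x) :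
    deriv (fun y => (f y : ℂ)) x = ((deriv f x : ℝ) : ℂ) :=
  hf.hasDerivAt.ofReal_comp.deriv

lemma SchwartzMap.deriv_complexify (φ : 𝓢(ℝ, ℝ)) (x : ℝ) :
    deriv φ.complexify x = ((deriv φ x : ℝ) : ℂ) :=
  deriv_ofReal_comp φ.differentiableAt

lemma SchwartzMap.deriv_deriv_complexify (φ : 𝓢(ℝ, ℝ)) (x : ℝ) :
    deriv (deriv φ.complexify) x = ((deriv (deriv φ) x : ℝ) : ℂ) := by
  rw [show deriv φ.complexify = fun y => ((deriv φ y : ℝ) : ℂ) from funext φ.deriv_complexify]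
  exact deriv_ofReal_comp (SchwartzMap.derivCLM ℝ ℝ φ).differentiableAt

lemma integral_complexify (f : Lp ℝ 2 (volume : Measure ℝ)) (φ : ℝ → ℝ) :
    ((∫ x, f x * φ x : ℝ) : ℂ) = ∫ x, complexify f x * (φ x : ℂ) := by
  rw [← integral_complex_ofReal]
  refine integral_congr_ae ?_
  filter_upwards [coeFn_complexify f] with x hx
  rw [hx, Complex.ofReal_mul]

lemma SchwartzMap.complexify_eq_fourier (φ : 𝓢(ℝ, ℝ)) : 𝓕 (𝓕⁻ φ.complexify) = φ.complexify := by
  simp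

/-- Writing `φ` as the transform of `𝓕⁻ φ` turns differentiation into multiplication by
`-derivSymbol` and moves the Fourier transform onto `f`. -/
lemma integral_mul_deriv_schwartz (f : Lp ℝ 2 (volume : Measure ℝ)) (φ : 𝓢(ℝ, ℝ)) :
    ((∫ x, f x * deriv φ x : ℝ) : ℂ) =
      ∫ ξ, (𝓕 (complexify f) : Lp ℂ 2 (volume : Measure ℝ)) ξ *
        (-derivSymbol ξ * (𝓕⁻ φ.complexify : 𝓢(ℝ, ℂ)) ξ) := by
  have hg : (fun ξ => -derivSymbol ξ).HasTemperateGrowth := hasTemperateGrowth_derivSymbol.neg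
  rw [integral_complexify]
  simp only [← φ.deriv_complexify]
  conv_lhs => rw [← φ.complexify_eq_fourier, deriv_fourier_schwartz]
  rw [← integral_fourier_mul_schwartz]
  simp only [SchwartzMap.smulLeftCLM_apply_apply hg, smul_eq_mul]

lemma integral_mul_sub_deriv_deriv_schwartz (f : Lp ℝ 2 (volume : Measure ℝ)) (φ : 𝓢(ℝ, ℝ)) :
    ((∫ x, f x * (φ x - deriv (deriv φ) x) : ℝ) : ℂ) =
      ∫ ξ, (𝓕 (complexify f) : Lp ℂ 2 (volume : Measure ℝ)) ξ *
        ((besselWeight 2 ξ : ℂ) * (𝓕⁻ φ.complexify : 𝓢(ℝ, ℂ)) ξ) := by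
  rw [integral_complexify f fun x => φ x - deriv (deriv φ) x]
  have h (x : ℝ) : ((φ x - deriv (deriv φ) x : ℝ) : ℂ) =
      (𝓕 (SchwartzMap.smulLeftCLM ℂ (fun ξ => (besselWeight 2 ξ : ℂ))
        (𝓕⁻ φ.complexify)) : 𝓢(ℝ, ℂ)) x := by
    rw [← fourier_sub_deriv_deriv, φ.complexify_eq_fourier, φ.deriv_deriv_complexify,
      φ.complexify_apply, Complex.ofReal_sub]
  simp only [h]
  rw [← integral_fourier_mul_schwartz]
  simp only [SchwartzMap.smulLeftCLM_apply_apply (hasTemperateGrowth_besselWeight 2), smul_eq_mul]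

lemma isWeakDeriv_of_fourier {f g : Lp ℝ 2 (volume : Measure ℝ)}
    (h : (𝓕 (complexify g) : Lp ℂ 2 (volume : Measure ℝ)) =ᵐ[volume]
      fun ξ => derivSymbol ξ * (𝓕 (complexify f) : Lp ℂ 2 (volume : Measure ℝ)) ξ) :
    IsWeakDeriv f g := by
  intro φ
  apply Complex.ofReal_injective
  rw [integral_mul_deriv_schwartz, Complex.ofReal_neg, integral_complexify]
  simp only [← φ.complexify_apply]
  conv_rhs => rw [← φ.complexify_eq_fourier]
  rw [← integral_fourier_mul_schwartz, ← integral_neg]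
  refine integral_congr_ae ?_
  filter_upwards [h] with ξ hξ
  rw [hξ]
  ring

lemma IsWeakDeriv.unique {f g g' : Lp ℝ 2 (volume : Measure ℝ)} (h : IsWeakDeriv f g)
    (h' : IsWeakDeriv f g') : g = g' :=
  Lp.ext (ae_eq_of_forall_integral_mul_real_schwartz (Lp.locallyIntegrable_two g)
    (Lp.locallyIntegrable_two g') fun φ => neg_injective ((h φ).symm.trans (h' φ)))

/-- The multiplier of order `-2` inverts `1 - ∂ₓ²` on complex Schwartz functions; taking real parts
is harmless because the operator has real coefficients. -/
lemma exists_schwartz_sub_deriv_deriv_eq (χ : 𝓢(ℝ, ℝ)) :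
    ∃ φ : 𝓢(ℝ, ℝ), ∀ x, φ x - deriv (deriv φ) x = χ x := by
  set Φ : 𝓢(ℝ, ℂ) := 𝓕 (SchwartzMap.smulLeftCLM ℂ (fun ξ => (besselWeight (-2) ξ : ℂ))
    (𝓕⁻ χ.complexify)) with hΦ
  have hΦχ : ∀ x, Φ x - deriv (deriv Φ) x = χ x := by
    intro x
    rw [hΦ, fourier_sub_deriv_deriv, ← χ.complexify_apply]
    conv_rhs => rw [← χ.complexify_eq_fourier]
    congr 2
    ext ξ
    rw [SchwartzMap.smulLeftCLM_apply_apply (hasTemperateGrowth_besselWeight 2),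
      SchwartzMap.smulLeftCLM_apply_apply (hasTemperateGrowth_besselWeight (-2)), smul_smul,
      ← Complex.ofReal_mul, ← besselWeight_add, add_neg_cancel, besselWeight_zero,
      Complex.ofReal_one, one_smul]
  have hre : ∀ (Ψ : 𝓢(ℝ, ℂ)) (x : ℝ), deriv (fun y => (Ψ y).re) x = (deriv Ψ x).re :=
    fun Ψ x => (Complex.reCLM.hasFDerivAt.comp_hasDerivAt x (Ψ.hasDerivAt x)).deriv
  refine ⟨SchwartzMap.postcompCLM (𝕜 := ℝ) Complex.reCLM Φ, fun x => ?_⟩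
  have h1 : deriv (SchwartzMap.postcompCLM (𝕜 := ℝ) Complex.reCLM Φ) =
      fun y => (SchwartzMap.derivCLM ℝ ℂ Φ y).re := funext (hre Φ)
  rw [h1, hre]
  change (Φ x).re - (deriv (deriv Φ) x).re = χ x
  rw [← Complex.sub_re, hΦχ, Complex.ofReal_re]

/-- The weak equation determines `w = u_t`. -/
lemma ThetaZeroEq.unique {u w w' : Lp ℝ 2 (volume : Measure ℝ)} (h : ThetaZeroEq u w)
    (h' : ThetaZeroEq u w') : w = w' := by
  obtain ⟨v, hv, hw⟩ := h
  obtain ⟨v', hv', hw'⟩ := h'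
  obtain rfl := hv.unique hv'
  refine Lp.ext (ae_eq_of_forall_integral_mul_real_schwartz (Lp.locallyIntegrable_two w)
    (Lp.locallyIntegrable_two w') fun χ => ?_)
  obtain ⟨φ, hφ⟩ := exists_schwartz_sub_deriv_deriv_eq χ
  have h := (hw φ).trans (hw' φ).symm
  simpa only [hφ] using h

/-! ### Squares on the Fourier side -/

open scoped Convolution in
/-- The convolution of a function with itself. -/
noncomputable def selfConv (f : ℝ → ℂ) : ℝ → ℂ := f ⋆[ContinuousLinearMap.mul ℂ ℂ] f

lemma selfConv_apply (f : ℝ → ℂ) (ξ : ℝ) : selfConv f ξ = ∫ η, f η * f (ξ - η) := rfl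

lemma integrable_selfConv {f : ℝ → ℂ} (hf : Integrable f) : Integrable (selfConv f) :=
  hf.integrable_convolution _ hf

lemma fourierInv_selfConv {f : ℝ → ℂ} (hf : Integrable f) (x : ℝ) :
    𝓕⁻ (selfConv f) x = 𝓕⁻ f x ^ 2 := by
  rw [Real.fourierInv_eq_fourier_neg, Real.fourierInv_eq_fourier_neg, selfConv,
    Real.fourier_mul_convolution_eq hf hf, sq]

/-- Integrability of the transform allows pointwise inversion, so `f²` is the inverse transform of
the self-convolution. -/
lemma integral_sq_mul_deriv_schwartz (f : Lp ℝ 2 (volume : Measure ℝ))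
    (hf : Integrable (𝓕 (complexify f) : Lp ℂ 2 (volume : Measure ℝ))) (φ : 𝓢(ℝ, ℝ)) :
    ((∫ x, f x ^ 2 * deriv φ x : ℝ) : ℂ) =
      ∫ ξ, selfConv (𝓕 (complexify f) : Lp ℂ 2 (volume : Measure ℝ)) ξ *
        (-derivSymbol ξ * (𝓕⁻ φ.complexify : 𝓢(ℝ, ℂ)) ξ) := by
  have hg : (fun ξ => -derivSymbol ξ).HasTemperateGrowth := hasTemperateGrowth_derivSymbol.neg
  have h := integral_fourierInv_mul_schwartz (integrable_selfConv hf)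
    (SchwartzMap.smulLeftCLM ℂ (fun ξ => -derivSymbol ξ) (𝓕⁻ φ.complexify))
  rw [← deriv_fourier_schwartz, φ.complexify_eq_fourier] at h
  simp only [SchwartzMap.smulLeftCLM_apply_apply hg, smul_eq_mul] at h
  rw [← h, ← integral_complex_ofReal]
  refine integral_congr_ae ?_
  filter_upwards [coeFn_complexify f, Lp.ae_eq_fourierInv hf] with x h1 h2
  rw [fourierInv_selfConv hf, ← h2, h1, φ.deriv_complexify]
  push_cast
  rfl

lemma integrable_sq_mul_deriv_schwartz (f : Lp ℝ 2 (volume : Measure ℝ)) (φ : 𝓢(ℝ, ℝ)) :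
    Integrable fun x => f x ^ 2 * deriv φ x :=
  (memLp_one_iff_integrable.2 (Lp.memLp f).integrable_sq).integrable_mul
    (show MemLp (deriv φ) ∞ volume from (SchwartzMap.derivCLM ℝ ℝ φ).memLp ∞ volume)

lemma integrable_mul_schwartz {f : ℝ → ℂ} (hf : Integrable f) (ψ : 𝓢(ℝ, ℂ)) :
    Integrable fun x => f x * ψ x :=
  (memLp_one_iff_integrable.2 hf).integrable_mul (ψ.memLp ∞)

/-! ### The weak equation as a differential equation in `H^s(ℝ)` -/

section

variable {s : ℝ}

namespace SobolevH

lemma integrable_hat (hs : 3 / 2 < s) (u : SobolevH s) : Integrable (hat u) := by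
  refine (integrable_besselWeight_mul_hat hs u).mono (Lp.aestronglyMeasurable _)
    (ae_of_all _ fun ξ => ?_)
  rw [norm_mul, Complex.norm_real, Real.norm_of_nonneg (besselWeight_pos _ _).le]
  exact le_mul_of_one_le_left (norm_nonneg _) (one_le_besselWeight zero_le_one ξ)

lemma integrable_derivSymbol_mul_hat (hs : 3 / 2 < s) (u : SobolevH s) :
    Integrable fun ξ => derivSymbol ξ * hat u ξ := by
  refine (integrable_besselWeight_mul_hat hs u).mono
    (continuous_derivSymbol.aestronglyMeasurable.mul (Lp.aestronglyMeasurable _))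
    (ae_of_all _ fun ξ => ?_)
  rw [norm_mul, norm_mul, Complex.norm_real, Real.norm_of_nonneg (besselWeight_pos _ _).le,
    norm_derivSymbol]
  gcongr
  exact abs_le_besselWeight_one ξ

/-- The right-hand side is Hermitian, and square integrable because `s ≥ 1`; so it is the transform
of a real function, which serves as `u_x`. -/
lemma exists_weakDeriv (hs : 1 ≤ s) (u : SobolevH s) : ∃ v : Lp ℝ 2 (volume : Measure ℝ),
    (𝓕 (_root_.complexify v) : Lp ℂ 2 (volume : Measure ℝ)) =ᵐ[volume]
      fun ξ => derivSymbol ξ * hat u ξ := by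
  have hmem : MemLp (fun ξ => derivSymbol ξ * hat u ξ) 2 volume := by
    refine (Lp.memLp (bessel s u)).mono
      (continuous_derivSymbol.aestronglyMeasurable.mul (Lp.aestronglyMeasurable _)) ?_
    filter_upwards [coeFn_bessel u] with ξ hξ
    rw [hξ, norm_mul, norm_mul, Complex.norm_real, Real.norm_of_nonneg (besselWeight_pos _ _).le,
      norm_derivSymbol]
    gcongr
    refine (abs_le_besselWeight_one ξ).trans ?_
    rw [show s = 1 + (s - 1) by ring, besselWeight_add]
    exact le_mul_of_one_le_right (besselWeight_pos _ _).le
      (one_le_besselWeight (by linarith) ξ)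
  obtain ⟨v, hv⟩ := exists_fourier_complexify_eq (f := hmem.toLp _) (by
    rw [conjReflect_eq_self_iff]
    filter_upwards [hmem.coeFn_toLp, ae_comp_neg hmem.coeFn_toLp, hat_neg_ae u] with ξ h1 h2 h3
    rw [h1, h2, h3, map_mul, derivSymbol_neg])
  exact ⟨v, by rw [hv]; exact hmem.coeFn_toLp⟩

lemma toL2_injective : Function.Injective (toL2 : SobolevH s → Lp ℝ 2 (volume : Measure ℝ)) :=
  Subtype.val_injective

end SobolevH

open SobolevH in
-- Undoing the weights in `thetaKernel` leaves the multiplier times a difference of two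
-- convolutions. Splitting the integral is legitimate for almost every `ξ`, since both convolved
-- functions are integrable.
lemma hat_thetaField (hs : 3 / 2 < s) (u : SobolevH s) :
    ∀ᵐ ξ, hat (thetaField hs u) ξ * besselWeight 2 ξ = derivSymbol ξ *
      ((selfConv (fun η => derivSymbol η * hat u η) ξ - selfConv (hat u) ξ) / 2) := by
  have ha := integrable_hat hs u
  have hb := integrable_derivSymbol_mul_hat hs u
  filter_upwards [hat_ae_eq (thetaField hs u), (memLp_thetaConv hs (bessel s u)).coeFn_toLp,
    ha.ae_convolution_exists (ContinuousLinearMap.mul ℂ ℂ) ha,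
    hb.ae_convolution_exists (ContinuousLinearMap.mul ℂ ℂ) hb] with ξ h1 h2 h3 h4
  rw [h1, bessel_thetaField, h2, selfConv_apply, selfConv_apply]
  have h5 := integral_sub h4 h3
  simp only [ContinuousLinearMap.mul_apply'] at h5
  rw [← h5, kernelConv]
  have hw : (besselWeight (-s) ξ * besselWeight (s - 2) ξ * besselWeight 2 ξ : ℂ) = 1 := by
    rw [← Complex.ofReal_mul, ← Complex.ofReal_mul, ← besselWeight_add, ← besselWeight_add,
      show -s + (s - 2) + 2 = 0 by ring, besselWeight_zero, Complex.ofReal_one]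
  have h6 : ∫ η, thetaKernel s ξ η * (bessel s u η * bessel s u (ξ - η)) =
      besselWeight (s - 2) ξ * derivSymbol ξ / 2 *
        ∫ η, (derivSymbol η * hat u η * (derivSymbol (ξ - η) * hat u (ξ - η)) -
          hat u η * hat u (ξ - η)) := by
    rw [← integral_const_mul]
    refine integral_congr_ae ?_
    filter_upwards [hat_ae_eq u, ae_comp_sub (hat_ae_eq u) ξ] with η h7 h8
    rw [h7, h8, thetaKernel]
    ring
  rw [h6]
  linear_combination derivSymbol ξ / 2 *
    (∫ η, (derivSymbol η * hat u η * (derivSymbol (ξ - η) * hat u (ξ - η)) -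
      hat u η * hat u (ξ - η))) * hw

open SobolevH in
lemma thetaZeroEq_thetaField (hs : 3 / 2 < s) (u : SobolevH s) :
    ThetaZeroEq (toL2 u) (toL2 (thetaField hs u)) := by
  have hs1 : 1 ≤ s := by linarith
  obtain ⟨v, hv⟩ := exists_weakDeriv hs1 u
  refine ⟨v, isWeakDeriv_of_fourier hv, fun φ => ?_⟩
  have hg : (fun ξ => -derivSymbol ξ).HasTemperateGrowth := hasTemperateGrowth_derivSymbol.neg
  have ha := integrable_hat hs u
  have hb := integrable_derivSymbol_mul_hat hs u
  have hbv : Integrable (𝓕 (complexify v) : Lp ℂ 2 (volume : Measure ℝ)) := hb.congr hv.symm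
  -- The two functions agree only almost everywhere, but their self-convolutions agree at every
  -- point.
  have hconv : selfConv (𝓕 (complexify v) : Lp ℂ 2 (volume : Measure ℝ)) =
      selfConv fun η => derivSymbol η * hat u η := by
    ext ξ
    refine integral_congr_ae ?_
    filter_upwards [hv, ae_comp_sub hv ξ] with η h1 h2
    simp only [ContinuousLinearMap.mul_apply', h1, h2]
  have hsplit : ∫ x, (v x ^ 2 / 2 - toL2 u x ^ 2 / 2) * deriv φ x =
      (∫ x, v x ^ 2 * deriv φ x) / 2 - (∫ x, toL2 u x ^ 2 * deriv φ x) / 2 := by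
    rw [← integral_div, ← integral_div, ← integral_sub
      ((integrable_sq_mul_deriv_schwartz v φ).div_const 2)
      ((integrable_sq_mul_deriv_schwartz (toL2 u) φ).div_const 2)]
    congr 1 with x
    ring
  apply Complex.ofReal_injective
  rw [integral_mul_sub_deriv_deriv_schwartz, hsplit, Complex.ofReal_neg, Complex.ofReal_sub,
    Complex.ofReal_div, Complex.ofReal_div, integral_sq_mul_deriv_schwartz v hbv,
    integral_sq_mul_deriv_schwartz (toL2 u) ha, hconv]
  set ψ : 𝓢(ℝ, ℂ) := 𝓕⁻ φ.complexify
  change ∫ ξ, hat (thetaField hs u) ξ * _ = -(_ - (∫ ξ, selfConv (hat u) ξ * _) / _)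
  have hi {f : ℝ → ℂ} (hf : Integrable f) :
      Integrable fun ξ => selfConv f ξ * (-derivSymbol ξ * ψ ξ) := by
    have h := integrable_mul_schwartz (integrable_selfConv hf)
      (SchwartzMap.smulLeftCLM ℂ (fun ξ => -derivSymbol ξ) ψ)
    simpa only [SchwartzMap.smulLeftCLM_apply_apply hg, smul_eq_mul] using h
  rw [Complex.ofReal_ofNat, ← integral_div, ← integral_div, ← integral_sub
    ((hi hb).div_const 2) ((hi ha).div_const 2), ← integral_neg]
  refine integral_congr_ae ?_
  filter_upwards [hat_thetaField hs u] with ξ hξ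
  linear_combination ψ ξ * hξ

/-- Since the weak equation forces the time derivative to be `thetaField hs u`, solutions of the
Cauchy problem and of the differential equation are the same. -/
lemma thetaZeroEq_iff (hs : 3 / 2 < s) (u w : SobolevH s) :
    ThetaZeroEq (SobolevH.toL2 u) (SobolevH.toL2 w) ↔ w = thetaField hs u :=
  ⟨fun h => SobolevH.toL2_injective (h.unique (thetaZeroEq_thetaField hs u)),
    fun h => h ▸ thetaZeroEq_thetaField hs u⟩

lemma IsSolution.isForwardSolution (hs : 3 / 2 < s) {u₀ : SobolevH s} {T : EReal}
    {u ut : ℝ → SobolevH s} (h : IsSolution s u₀ T u ut) :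
    IsForwardSolution (thetaField hs) u₀ T u :=
  ⟨h.pos, h.initial, fun t ht => (thetaZeroEq_iff hs _ _).1 (h.equation t ht) ▸ h.hasDeriv t ht⟩

lemma IsForwardSolution.isSolution (hs : 3 / 2 < s) {u₀ : SobolevH s} {T : EReal}
    {u : ℝ → SobolevH s} (h : IsForwardSolution (thetaField hs) u₀ T u) :
    IsSolution s u₀ T u fun t => thetaField hs (u t) :=
  ⟨h.pos, h.initial, h.continuousOn, h.hasDeriv,
    (lipschitzOnBalls_thetaField hs).continuous.comp_continuousOn h.continuousOn,
    fun _ _ => thetaZeroEq_thetaField hs _⟩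

end

theorem theorem5p1 (s : ℝ) (hs : 3 / 2 < s) :
    ∃ (δ : ℝ → ℝ) (T : SobolevH s → EReal) (u ut : SobolevH s → ℝ → SobolevH s),
      -- the existence time is bounded below in terms of the norm of the data
      (∀ R, 0 < δ R) ∧
      (∀ R, ∀ u₀ : SobolevH s, ‖u₀‖ ≤ R → (δ R : EReal) ≤ T u₀) ∧
      -- existence on `[0, T(u₀))`
      (∀ u₀ : SobolevH s, IsSolution s u₀ (T u₀) (u u₀) (ut u₀)) ∧
      -- uniqueness, and maximality of `T(u₀)`
      (∀ (u₀ : SobolevH s) (S : EReal) (v vt : ℝ → SobolevH s), IsSolution s u₀ S v vt →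
        S ≤ T u₀ ∧ EqOn v (u u₀) (timeInterval S)) ∧
      -- continuous dependence in `C ∩ C¹`, uniformly on compact time intervals
      (∀ (u₀ : SobolevH s) (τ : ℝ), 0 ≤ τ → (τ : EReal) < T u₀ →
        (∀ᶠ v₀ in 𝓝 u₀, (τ : EReal) < T v₀) ∧
        TendstoUniformlyOn u (u u₀) (𝓝 u₀) (Icc 0 τ) ∧
        TendstoUniformlyOn ut (ut u₀) (𝓝 u₀) (Icc 0 τ)) ∧
      -- blow-up of the norm when the maximal time is finite
      (∀ (u₀ : SobolevH s) (τ : ℝ), T u₀ = (τ : EReal) →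
        Tendsto (fun t => ‖u u₀ t‖) (𝓝[<] τ) atTop) := by
  have : CompleteSpace (SobolevH s) := SobolevH.completeSpace (by linarith)
  have hF := lipschitzOnBalls_thetaField hs
  -- The local existence time depends on the radius alone, so it serves as `δ`.
  choose δ hδ hloc using hF.exists_forwardSolution
  choose u hu using hF.exists_maximal
  refine ⟨δ, maximalTime (thetaField hs), u, fun u₀ t => thetaField hs (u u₀ t), hδ,
    fun R u₀ hR => ?_, fun u₀ => (hu u₀).isSolution hs, fun u₀ S v vt hv => ?_,
    fun u₀ τ _ hτ => hF.continuous_dependence hu hτ,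
    fun u₀ τ hτ => hF.tendsto_norm_atTop (hu u₀) hτ⟩
  · obtain ⟨v, hv⟩ := hloc R u₀ hR
    exact hv.le_maximalTime
  · have hv' := hv.isForwardSolution hs
    exact ⟨hv'.le_maximalTime, hv'.eqOn hF ((hu u₀).mono hv.pos hv'.le_maximalTime)⟩
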